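/- Let $V\subset\mathbb{R}$ be a set of $n$ points, regarded as labelled, and let the $\binom n2$ pairwise distances of $V$ be revealed one by one in a uniformly random order; for $0\le t\le\binom n2$ let $G_t$ be the graph on $V$ whose edges are the pairs whose distances are among the first $t$ revealed. Say that $V$ is *reconstructible* at time $t$ if the revealed distances determine the positions of the labelled points up to isometry: for every injective map $f\colon V\to\mathbb{R}$ with $|f(u)-f(v)|=|u-v|$ for all edges $uv$ of $G_t$, there is an isometry $g$ of $\mathbb{R}$ with $f(u)=g(u)$ for all $u\in V$. Call an ordered pair $(u,v)$ of distinct points of $V$ *secure* if the reflection $2v-u$ of $u$ over $v$ also lies in $V$. Then, with probability tending to $1$ as $n\to\infty$, uniformly over all $n$-point sets $V\subset\mathbb{R}$, the first time $t$ at which $V$ is reconstructible exists and is exactly the first time $t$ at which both of the following hold: (i) every point of $V$ is incident to at least one edge of $G_t$ (has at least one revealed distance); (ii) whenever a point $u\in V$ is incident to exactly one edge of $G_t$, say $uv$, the pair $(u,v)$ is secure. -/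

import Mathlib

namespace LineReconstruction

/-- The point set `V`, with its points labelled, is reconstructible from the distances between the
pairs of points that are adjacent in `G`: every placement of the labelled points at distinct
positions of the line which agrees with the known distances is the true one up to an isometry. -/
def Reconstructible (V : Finset ℝ) (G : SimpleGraph V) : Prop :=
  ∀ f : V → ℝ, Function.Injective f →
    (∀ u v : V, G.Adj u v → dist (f u) (f v) = dist (u : ℝ) (v : ℝ)) →
    ∃ g : ℝ ≃ᵢ ℝ, ∀ u : V, f u = g u

/-- The ordered pair `(u, v)` of distinct points of `V` is secure if the reflection `2v - u` of `u`
over `v` is also in `V`. -/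
def Secure (V : Finset ℝ) (u v : V) : Prop :=
  u ≠ v ∧ 2 * (v : ℝ) - (u : ℝ) ∈ V

/-- Every point is incident to at least one revealed distance, and if a point `u` is incident to
exactly one revealed distance, which is to `v`, then `(u, v)` is secure. -/
def NoIsolatedNoUndecidable (V : Finset ℝ) (G : SimpleGraph V) : Prop :=
  (∀ u : V, (G.neighborSet u).Nonempty) ∧
    ∀ u v : V, G.neighborSet u = {v} → Secure V u v

/-- An order in which the `n.choose 2` pairwise distances of the `n`-point set `V` are revealed. -/
abbrev RevealOrder (V : Finset ℝ) : Type :=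
  Fin (V.card.choose 2) ≃ (⊤ : SimpleGraph V).edgeSet

instance (V : Finset ℝ) : MeasurableSpace (RevealOrder V) := ⊤

/-- The graph of the first `t` revealed distances
(the complete graph as soon as `t` is at least `V.card.choose 2`). -/
def revealedGraph {V : Finset ℝ} (σ : RevealOrder V) (t : ℕ) : SimpleGraph V :=
  SimpleGraph.fromEdgeSet {e | ∃ i : Fin (V.card.choose 2), (i : ℕ) < t ∧ (σ i : Sym2 V) = e}

end LineReconstruction

namespace LineReconstruction

/-! Write `N` for the number of pairs. Both conditions are necessary at every time. An isolated
point can be moved almost anywhere, and a point `u` whose only neighbour is `v` can be reflected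
over `v` unless the reflected position is already taken. The content is sufficiency, at the first
time when the conditions hold.

An edge `uv` forces `f u - u = f v - v` or `f u + u = f v + v`. If any two disjoint sets of linear
size are joined by an edge, then one of the functions `f - id`, `f + id` is constant on almost all
of `V` (`exists_dominant_fibre`). After composing with an isometry, `f` therefore fixes almost every
point. A moved point is the reflection of its old position over each of its fixed neighbours, so it
has at most one fixed neighbour. Sparsity of small sets then rules out moved points of large degree.
The few points of low degree are far apart, so a moved one has only fixed neighbours, hence exactly
one, and it lands on a point of `V`. That point is either fixed, against injectivity, or is itself
moved and of low degree, which is excluded as well (`eq_self_of_pseudorandom`).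

For the probability, take times `m₁` near `2/5 * n log n` and `m₂` near `n log n`, on either side of
the threshold `1/2 * n log n` for isolated points. With high probability some point is isolated at
`m₁` (second moment), and all degrees are at least two at `m₂` (first moment), so the hitting time
lies between them. Increasing properties are checked at `m₁` and decreasing ones at `m₂`, and low
degree is always measured at `m₁`; so one set of exceptional events serves every intermediate time
(`compl_hittingTimesAgree_subset`). Chernoff and union bounds make these events rare. The bounds
depend on `V` only through its cardinality, which gives uniformity. -/

/-- The average of a function on a finite type. -/
noncomputable def avg {Ω : Type*} [Fintype Ω] (g : Ω → ℝ) : ℝ := (∑ σ, g σ) / Fintype.card Ω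

/-- The proportion of the elements of a finite type which lie in a given set. -/
noncomputable def pr {Ω : Type*} [Fintype Ω] (A : Set Ω) : ℝ := avg (A.indicator (fun _ => (1 : ℝ)))

/-! ### Averages and proportions on a finite probability space. -/

section Avg
variable {Ω : Type*} [Fintype Ω]

lemma avg_mono {g h : Ω → ℝ} (H : ∀ σ, g σ ≤ h σ) : avg g ≤ avg h := by
  unfold avg
  gcongr with σ
  exact H σ

lemma avg_sum {ι : Type*} (s : Finset ι) (g : ι → Ω → ℝ) :
    avg (fun σ => ∑ i ∈ s, g i σ) = ∑ i ∈ s, avg (g i) := by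
  unfold avg
  rw [Finset.sum_comm, Finset.sum_div]

lemma avg_mul_left (c : ℝ) (g : Ω → ℝ) : avg (fun σ => c * g σ) = c * avg g := by
  unfold avg
  rw [← Finset.mul_sum, mul_div_assoc]

lemma avg_add (g h : Ω → ℝ) : avg (fun σ => g σ + h σ) = avg g + avg h := by
  unfold avg
  rw [Finset.sum_add_distrib, add_div]

lemma avg_const [Nonempty Ω] (c : ℝ) : avg (fun _ : Ω => c) = c := by
  unfold avg
  have : (Fintype.card Ω : ℝ) ≠ 0 := by exact_mod_cast Fintype.card_ne_zero
  simp [this]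

/-- The inequality of Markov. -/
lemma pr_le_avg {A : Set Ω} {g : Ω → ℝ} (h0 : ∀ σ, 0 ≤ g σ) (h1 : ∀ σ ∈ A, 1 ≤ g σ) :
    pr A ≤ avg g := by
  refine avg_mono fun σ => ?_
  by_cases h : σ ∈ A
  · simpa [h] using h1 σ h
  · simpa [h] using h0 σ

lemma pr_mono {A B : Set Ω} (h : A ⊆ B) : pr A ≤ pr B :=
  avg_mono fun σ => Set.indicator_le_indicator_of_subset h (fun _ => zero_le_one) σ

lemma pr_iUnion_le {ι : Type*} (s : Finset ι) (A : ι → Set Ω) {B : Set Ω}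
    (h : ∀ σ ∈ B, ∃ i ∈ s, σ ∈ A i) : pr B ≤ ∑ i ∈ s, pr (A i) := by
  unfold pr
  rw [← avg_sum]
  have h0 : ∀ σ, ∀ i ∈ s, 0 ≤ (A i).indicator (fun _ => (1 : ℝ)) σ := fun σ i _ =>
    Set.indicator_nonneg (fun _ _ => zero_le_one) σ
  refine pr_le_avg (fun σ => Finset.sum_nonneg (h0 σ)) fun σ hσ => ?_
  obtain ⟨i, hi, hiσ⟩ := h σ hσ
  refine le_trans ?_ (Finset.single_le_sum (h0 σ) hi)
  simp [hiσ]

lemma pr_union_le (A B : Set Ω) : pr (A ∪ B) ≤ pr A + pr B := by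
  unfold pr
  rw [← avg_add]
  have h0 : ∀ (C : Set Ω) σ, 0 ≤ C.indicator (fun _ => (1 : ℝ)) σ := fun C σ =>
    Set.indicator_nonneg (fun _ _ => zero_le_one) σ
  refine pr_le_avg (fun σ => add_nonneg (h0 _ _) (h0 _ _)) ?_
  rintro σ (h | h)
  · have := h0 B σ
    simp [h, this]
  · have := h0 A σ
    simp [h, this]

lemma pr_compl [Nonempty Ω] (A : Set Ω) : pr Aᶜ = 1 - pr A := by
  have : pr A + pr Aᶜ = 1 := by
    unfold pr
    rw [← avg_add]
    conv_rhs => rw [← avg_const (Ω := Ω) 1]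
    congr 1
    ext σ
    by_cases h : σ ∈ A <;> simp [h]
  linarith

open Classical in
lemma pr_eq_card (A : Set Ω) :
    pr A = (Finset.univ.filter (· ∈ A)).card / Fintype.card Ω := by
  unfold pr avg
  simp [Set.indicator_apply]

lemma uniformOn_univ_real [MeasurableSpace Ω] [MeasurableSingletonClass Ω] (A : Set Ω) :
    (ProbabilityTheory.uniformOn (Set.univ : Set Ω)).real A = pr A := by
  classical
  rw [pr_eq_card, MeasureTheory.measureReal_def, ProbabilityTheory.uniformOn_univ,
    MeasureTheory.Measure.count_apply_finite A (Set.toFinite A)]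
  simp only [ENNReal.toReal_div, ENNReal.toReal_natCast]
  congr 3
  ext; simp

end Avg

/-! ### Uniformly random orders: early and late elements, exponential moments. -/

section Orders
variable {β : Type*} [Fintype β] [DecidableEq β] {N : ℕ}

open Classical in
/-- Each injection of `T` extends to the same number of bijections. -/
lemma card_equiv_restrict (hN : Fintype.card β = N) (T : Finset β) (C : Finset (T ↪ Fin N)) :
    (Finset.univ.filter (fun σ : Fin N ≃ β =>
      (Function.Embedding.subtype (· ∈ T)).trans σ.symm.toEmbedding ∈ C)).card
      = C.card * (N - T.card).factorial := by
  rw [Finset.card_eq_sum_card_fiberwise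
    (f := fun σ : Fin N ≃ β => (Function.Embedding.subtype (· ∈ T)).trans σ.symm.toEmbedding)
    (t := C) (by intro σ hσ; simpa using hσ)]
  rw [Finset.sum_const_nat]
  intro ι hι
  rw [Finset.filter_filter]
  let e₀ : (T : Set β) ≃ (Set.range ι) := Equiv.ofInjective ι ι.injective
  have e1 := Equiv.Set.compl e₀
  have hc : Fintype.card ((T : Set β)ᶜ : Set β) = N - T.card := by
    rw [Fintype.card_compl_set, hN]; simp
  have hc2 : Fintype.card ((Set.range ι)ᶜ : Set (Fin N)) = N - T.card := by
    rw [Fintype.card_compl_set, Fintype.card_fin, Set.card_range_of_injective ι.injective]; simp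
  have h2 : Fintype.card { e : β ≃ Fin N // ∀ x : (T : Set β), e x = e₀ x }
      = (N - T.card).factorial := by
    rw [Fintype.card_congr e1, Fintype.card_equiv (Fintype.equivOfCardEq (hc.trans hc2.symm)), hc]
  rw [← h2, ← Fintype.card_coe]
  refine Fintype.card_congr
    { toFun := fun σ => ⟨σ.1.symm, ?_⟩
      invFun := fun τ => ⟨τ.1.symm, ?_⟩
      left_inv := fun σ => by simp
      right_inv := fun τ => by simp }
  · intro x
    have := (Finset.mem_filter.1 σ.2).2.2
    have := congrArg (fun g : T ↪ Fin N => g x) this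
    simpa [e₀] using this
  · have key : (Function.Embedding.subtype (· ∈ T)).trans τ.1.symm.symm.toEmbedding = ι := by
      ext x
      have := τ.2 x
      simp only [Equiv.symm_symm, Function.Embedding.trans_apply, Function.Embedding.subtype_apply,
        Equiv.coe_toEmbedding]
      rw [this]
      simp [e₀]
    simp only [Finset.mem_filter, Finset.mem_univ, true_and]
    exact ⟨by rw [key]; exact hι, key⟩

open Classical in
-- The positions of the elements of `T` form a uniformly random injection, because every injection
-- has `(N - T.card)!` extensions. Every probability about finitely many elements thus reduces to
-- counting injections.
lemma pr_restrict (hN : Fintype.card β = N) (T : Finset β) (C : Finset (T ↪ Fin N)) :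
    pr {σ : Fin N ≃ β | (Function.Embedding.subtype (· ∈ T)).trans σ.symm.toEmbedding ∈ C}
      = C.card / N.descFactorial T.card := by
  have hT : T.card ≤ N := hN ▸ Finset.card_le_univ T
  have e : Fin N ≃ β := (Fintype.equivFinOfCardEq hN).symm
  rw [pr_eq_card]
  simp only [Set.mem_ofPred_eq]
  rw [card_equiv_restrict hN, Fintype.card_equiv e, Fintype.card_fin,
    ← Nat.factorial_mul_descFactorial hT]
  have h1 : ((N - T.card).factorial : ℝ) ≠ 0 := by positivity
  push_cast
  rw [mul_comm, mul_div_mul_left _ _ h1]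

open Classical in
/-- The probability that all of `W` comes after the first `m` elements. -/
lemma pr_late (hN : Fintype.card β = N) (W : Finset β) (m : ℕ) (hm : m ≤ N) :
    pr {σ : Fin N ≃ β | ∀ e ∈ W, m ≤ (σ.symm e : ℕ)}
      = (N - m).descFactorial W.card / N.descFactorial W.card := by
  have := pr_restrict hN W (Finset.univ.filter (fun ι => ∀ e, m ≤ (ι e : ℕ)))
  convert this using 2
  · ext σ; simp
  · norm_cast
    have h3 : Fintype.card {i : Fin N // m ≤ (i : ℕ)} = N - m := by
      have : Fintype.card {i : Fin N // ¬ (i : ℕ) < m} = N - m := by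
        rw [Fintype.card_subtype_compl, Fintype.card_fin, Fintype.card_subtype]
        congr 1
        rw [Fin.card_filter_val_lt]; omega
      simpa using this
    rw [← Fintype.card_subtype, ← h3, ← Fintype.card_coe W, ← Fintype.card_embedding_eq]
    let e : {ι : W ↪ Fin N // ∀ e, m ≤ (ι e : ℕ)} ≃ (W ↪ {i : Fin N // m ≤ (i : ℕ)}) :=
      { toFun := fun ι => ⟨fun e => ⟨ι.1 e, ι.2 e⟩,
          fun a b h => ι.1.injective (congrArg Subtype.val h)⟩
        invFun := fun ι => ⟨ι.trans (Function.Embedding.subtype _), fun e => (ι e).2⟩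
        left_inv := fun ι => rfl
        right_inv := fun ι => rfl }
    exact Fintype.card_congr e.symm

open Classical in
/-- The probability that `F` is among the first `m₂` elements and `W` after the first `m₁`. -/
lemma pr_early_late_le (hN : Fintype.card β = N) (F W : Finset β) (hd : Disjoint F W)
    (m₁ m₂ : ℕ) (hm₁ : m₁ ≤ N) (hm₂ : m₂ ≤ N) :
    pr {σ : Fin N ≃ β | (∀ e ∈ F, (σ.symm e : ℕ) < m₂) ∧ ∀ e ∈ W, m₁ ≤ (σ.symm e : ℕ)}
      ≤ m₂.descFactorial F.card * (N - m₁).descFactorial W.card /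
        N.descFactorial (F.card + W.card) := by
  have := pr_restrict hN (F ∪ W) (Finset.univ.filter (fun ι =>
    (∀ e, e.1 ∈ F → (ι e : ℕ) < m₂) ∧ ∀ e, e.1 ∈ W → m₁ ≤ (ι e : ℕ)))
  rw [Finset.card_union_of_disjoint hd] at this
  have h0 : {σ : Fin N ≃ β | (∀ e ∈ F, (σ.symm e : ℕ) < m₂) ∧ ∀ e ∈ W, m₁ ≤ (σ.symm e : ℕ)} =
    {σ : Fin N ≃ β | (Function.Embedding.subtype (· ∈ F ∪ W)).trans σ.symm.toEmbedding ∈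
      (Finset.univ.filter (fun ι : (F ∪ W : Finset β) ↪ Fin N =>
    (∀ e, e.1 ∈ F → (ι e : ℕ) < m₂) ∧ ∀ e, e.1 ∈ W → m₁ ≤ (ι e : ℕ)))} := by
    ext σ
    simp only [Set.mem_ofPred_eq, Finset.mem_filter, Finset.mem_univ, true_and]
    refine and_congr ⟨fun h e he => h _ he, fun h e he => h ⟨e, Finset.mem_union_left _ he⟩ he⟩
      ⟨fun h e he => h _ he, fun h e he => h ⟨e, Finset.mem_union_right _ he⟩ he⟩
  rw [h0, this]
  gcongr
  norm_cast
  have h3 : Fintype.card {i : Fin N // m₁ ≤ (i : ℕ)} = N - m₁ := by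
    have : Fintype.card {i : Fin N // ¬ (i : ℕ) < m₁} = N - m₁ := by
      rw [Fintype.card_subtype_compl, Fintype.card_fin, Fintype.card_subtype]
      congr 1
      rw [Fin.card_filter_val_lt]; omega
    simpa using this
  have h4 : Fintype.card {i : Fin N // (i : ℕ) < m₂} = m₂ := by
    rw [Fintype.card_subtype, Fin.card_filter_val_lt]; omega
  rw [← Fintype.card_subtype]
  conv_rhs => rw [← h3, ← Fintype.card_coe W, ← Fintype.card_embedding_eq]
  conv_rhs => rw [← h4, ← Fintype.card_coe F, ← Fintype.card_embedding_eq]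
  rw [← Fintype.card_prod]
  refine Fintype.card_le_of_injective (fun ι =>
    (⟨fun e => ⟨ι.1 ⟨e.1, Finset.mem_union_left _ e.2⟩, ι.2.1 _ e.2⟩, fun a b h => ?_⟩,
     ⟨fun e => ⟨ι.1 ⟨e.1, Finset.mem_union_right _ e.2⟩, ι.2.2 _ e.2⟩, fun a b h => ?_⟩)) ?_
  · have := ι.1.injective (congrArg Subtype.val h)
    exact Subtype.ext (by simpa using this)
  · have := ι.1.injective (congrArg Subtype.val h)
    exact Subtype.ext (by simpa using this)
  · intro ι κ h
    simp only [Prod.mk.injEq] at h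
    ext ⟨e, he⟩
    rcases Finset.mem_union.1 he with he' | he'
    · have := congrArg (fun g => (g ⟨e, he'⟩).1.1) h.1
      exact this
    · have := congrArg (fun g => (g ⟨e, he'⟩).1.1) h.2
      exact this

/-- Factor by factor, `(a - k) / (b - k) ≤ a / b` when `a ≤ b`. In this way sampling without
replacement is bounded by independent sampling. -/
lemma descFactorial_mul_pow_le {a b : ℕ} (hab : a ≤ b) (w : ℕ) :
    a.descFactorial w * b ^ w ≤ a ^ w * b.descFactorial w := by
  induction w with
  | zero => simp
  | succ k ih =>
    have h : (a - k) * b ≤ a * (b - k) := by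
      rw [Nat.sub_mul, Nat.mul_sub]
      have : k * a ≤ k * b := Nat.mul_le_mul_left _ hab
      have := mul_comm a k
      omega
    calc a.descFactorial (k + 1) * b ^ (k + 1)
        = ((a - k) * b) * (a.descFactorial k * b ^ k) := by
          rw [Nat.descFactorial_succ, pow_succ]; ring
      _ ≤ (a * (b - k)) * (a ^ k * b.descFactorial k) := Nat.mul_le_mul h ih
      _ = _ := by rw [Nat.descFactorial_succ, pow_succ]; ring

lemma descFactorial_div_le {a b w : ℕ} (hab : a ≤ b) (hw : w ≤ b) :
    (a.descFactorial w : ℝ) / b.descFactorial w ≤ ((a : ℝ) / b) ^ w := by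
  have h1 : 0 < b.descFactorial w := Nat.descFactorial_pos.2 hw
  rcases Nat.eq_zero_or_pos w with rfl | hw0
  · simp
  have h2 : 0 < b := by omega
  rw [div_pow, div_le_div_iff₀ (by exact_mod_cast h1) (by positivity)]
  exact_mod_cast descFactorial_mul_pow_le hab w

lemma descFactorial_add (N k w : ℕ) :
    N.descFactorial (k + w) = N.descFactorial k * (N - k).descFactorial w := by
  induction w with
  | zero => simp
  | succ w ih =>
    rw [← add_assoc, Nat.descFactorial_succ, ih, Nat.descFactorial_succ, Nat.sub_sub]; ring

/-- Placing `F` first leaves `N - F.card` positions for `W`. The condition `F.card ≤ m₁` keeps the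
ratio for a late element at most one, as the comparison with a power requires. -/
lemma pr_early_late_le_pow (hN : Fintype.card β = N) (F W : Finset β) (hd : Disjoint F W)
    (m₁ m₂ : ℕ) (hm₁ : m₁ ≤ N) (hm₂ : m₂ ≤ N) (hF : F.card ≤ m₁) :
    pr {σ : Fin N ≃ β | (∀ e ∈ F, (σ.symm e : ℕ) < m₂) ∧ ∀ e ∈ W, m₁ ≤ (σ.symm e : ℕ)}
      ≤ ((m₂ : ℝ) / N) ^ F.card * (((N - m₁ : ℕ) : ℝ) / (N - F.card : ℕ)) ^ W.card := by
  have hc : F.card + W.card ≤ N := by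
    rw [← Finset.card_union_of_disjoint hd, ← hN]; exact Finset.card_le_univ _
  refine (pr_early_late_le hN F W hd m₁ m₂ hm₁ hm₂).trans ?_
  rw [descFactorial_add]
  push_cast
  rw [mul_div_mul_comm]
  exact mul_le_mul (descFactorial_div_le hm₂ (by omega))
    (descFactorial_div_le (by omega) (by omega)) (by positivity) (by positivity)

/-- Exponential moment for the lower tail of the number of early elements of `D`, on the event
that all of `F` is early. -/
lemma avg_lower_moment_le (hN : Fintype.card β = N) (F D : Finset β) (hd : Disjoint F D)
    (m₁ m₂ : ℕ) (hm₁ : m₁ ≤ N) (hm₂ : m₂ ≤ N) (hF : F.card ≤ m₁) {s : ℝ} (hs0 : 0 ≤ s)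
    (hs1 : s ≤ 1) :
    avg (fun σ : Fin N ≃ β => {σ : Fin N ≃ β | ∀ e ∈ F, (σ.symm e : ℕ) < m₂}.indicator
        (fun _ => (1 : ℝ)) σ * s ^ (D.filter (fun e => (σ.symm e : ℕ) < m₁)).card)
      ≤ ((m₂ : ℝ) / N) ^ F.card *
        ((1 - s) * (((N - m₁ : ℕ) : ℝ) / (N - F.card : ℕ)) + s) ^ D.card := by
  have expand : ∀ σ : Fin N ≃ β, {σ : Fin N ≃ β | ∀ e ∈ F, (σ.symm e : ℕ) < m₂}.indicator
        (fun _ => (1 : ℝ)) σ * s ^ (D.filter (fun e => (σ.symm e : ℕ) < m₁)).card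
      = ∑ W ∈ D.powerset, ((1 - s) ^ W.card * s ^ (D.card - W.card)) *
        {σ : Fin N ≃ β | (∀ e ∈ F, (σ.symm e : ℕ) < m₂) ∧
          ∀ e ∈ W, m₁ ≤ (σ.symm e : ℕ)}.indicator (fun _ => (1 : ℝ)) σ := by
    intro σ
    -- An early element contributes `s` and a late one `(1 - s) + s = 1`. The expansion over sets
    -- `W` of late elements has nonnegative coefficients because `s ≤ 1`, so the bounds for the
    -- separate `W` can be summed.
    have h1 : s ^ (D.filter (fun e => (σ.symm e : ℕ) < m₁)).card
        = ∏ e ∈ D, ((if m₁ ≤ (σ.symm e : ℕ) then (1 - s) else 0) + s) := by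
      rw [← Finset.prod_const, Finset.prod_filter]
      refine Finset.prod_congr rfl fun e _ => ?_
      by_cases h : (σ.symm e : ℕ) < m₁
      · simp [h]
      · simp [h, not_lt.1 h]
    rw [h1, Finset.prod_add, Finset.mul_sum]
    refine Finset.sum_congr rfl fun W hW => ?_
    rw [Finset.prod_const, Finset.card_sdiff_of_subset (Finset.mem_powerset.1 hW)]
    by_cases h : ∀ e ∈ W, m₁ ≤ (σ.symm e : ℕ)
    · rw [Finset.prod_congr rfl (fun e he => if_pos (h e he)), Finset.prod_const]
      by_cases hF' : ∀ e ∈ F, (σ.symm e : ℕ) < m₂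
      · simp only [Set.indicator, Set.mem_ofPred_eq]
        rw [if_pos hF', if_pos ⟨hF', h⟩]; ring
      · simp only [Set.indicator, Set.mem_ofPred_eq]
        rw [if_neg hF', if_neg (fun H => hF' H.1)]; ring
    · have h' := h
      push Not at h'
      obtain ⟨e, he, hlt⟩ := h'
      rw [Finset.prod_eq_zero he (if_neg (not_le.2 hlt))]
      simp only [Set.indicator, Set.mem_ofPred_eq]
      rw [if_neg (fun H : _ ∧ _ => h H.2)]; ring
  simp only [expand]
  rw [avg_sum, ← Finset.sum_pow_mul_eq_add_pow, Finset.mul_sum]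
  refine Finset.sum_le_sum fun W hW => ?_
  rw [avg_mul_left]
  have := pr_early_late_le_pow hN F W (hd.mono_right (Finset.mem_powerset.1 hW)) m₁ m₂ hm₁ hm₂ hF
  have h0 : 0 ≤ (1 - s) ^ W.card * s ^ (D.card - W.card) :=
    mul_nonneg (pow_nonneg (by linarith) _) (pow_nonneg hs0 _)
  refine (mul_le_mul_of_nonneg_left this h0).trans (le_of_eq ?_)
  rw [mul_pow]; ring

/-- Exponential moment for the upper tail of the number of early elements of `D`. -/
lemma avg_upper_moment_le (hN : Fintype.card β = N) (D : Finset β)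
    (m : ℕ) (hm : m ≤ N) {z : ℝ} (hz : 1 ≤ z) :
    avg (fun σ : Fin N ≃ β => z ^ (D.filter (fun e => (σ.symm e : ℕ) < m)).card)
      ≤ ((z - 1) * ((m : ℝ) / N) + 1) ^ D.card := by
  have expand : ∀ σ : Fin N ≃ β, z ^ (D.filter (fun e => (σ.symm e : ℕ) < m)).card
      = ∑ W ∈ D.powerset, (z - 1) ^ W.card *
        {σ : Fin N ≃ β | (∀ e ∈ W, (σ.symm e : ℕ) < m) ∧
          ∀ e ∈ (∅ : Finset β), N ≤ (σ.symm e : ℕ)}.indicator (fun _ => (1 : ℝ)) σ := by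
    intro σ
    have h1 : z ^ (D.filter (fun e => (σ.symm e : ℕ) < m)).card
        = ∏ e ∈ D, ((if (σ.symm e : ℕ) < m then (z - 1) else 0) + 1) := by
      rw [← Finset.prod_const, Finset.prod_filter]
      refine Finset.prod_congr rfl fun e _ => ?_
      by_cases h : (σ.symm e : ℕ) < m <;> simp [h]
    rw [h1, Finset.prod_add]
    refine Finset.sum_congr rfl fun W hW => ?_
    by_cases h : ∀ e ∈ W, (σ.symm e : ℕ) < m
    · rw [Finset.prod_congr rfl (fun e he => if_pos (h e he)), Finset.prod_const]
      simp only [Set.indicator, Set.mem_ofPred_eq]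
      rw [if_pos ⟨h, by simp⟩]; simp
    · have h' := h
      push Not at h'
      obtain ⟨e, he, hlt⟩ := h'
      rw [Finset.prod_eq_zero he (if_neg (not_lt.2 hlt))]
      simp only [Set.indicator, Set.mem_ofPred_eq]
      rw [if_neg (fun H : _ ∧ _ => h H.1)]; ring
  simp only [expand]
  rw [avg_sum, ← Finset.sum_pow_mul_eq_add_pow]
  refine Finset.sum_le_sum fun W hW => ?_
  rw [avg_mul_left]
  have hW' : W.card ≤ N := hN ▸ Finset.card_le_univ W
  -- There are no late elements here; taking `N` as the late threshold only serves to satisfy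
  -- `W.card ≤ m₁`.
  have := pr_early_late_le_pow hN W ∅ (Finset.disjoint_empty_right _) N m le_rfl hm hW'
  have h0 : 0 ≤ (z - 1) ^ W.card := pow_nonneg (by linarith) _
  refine (mul_le_mul_of_nonneg_left this h0).trans (le_of_eq ?_)
  rw [mul_pow]; simp

end Orders
-- Deterministic reconstruction from pseudorandomness, and necessity of the two conditions.
section Deterministic

/-- A function on a finite type with no dominant fibre has a balanced cut along its fibres. -/
lemma exists_balanced_cut {ι : Type*} [Fintype ι] [DecidableEq ι] (a : ι → ℝ) {x : ℝ}
    (hx0 : 0 < x) (hx : 3 * x ≤ Fintype.card ι)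
    (h : ∀ c, ((Finset.univ.filter (fun i => a i = c)).card : ℝ) ≤ Fintype.card ι - x) :
    ∃ X : Finset ι, (∀ i ∈ X, ∀ j ∉ X, a i ≠ a j) ∧ x ≤ X.card ∧ x ≤ (Xᶜ).card := by
  classical
  -- Take a smallest union of fibres with at least `x` elements. If it is a single fibre, the
  -- hypothesis bounds it. Otherwise, by minimality, one of its fibres and the remainder each have
  -- fewer than `x` elements, so its complement has more than `3 * x - 2 * x`.
  let 𝒳 : Finset (Finset ι) :=
    Finset.univ.filter (fun X => (∀ i ∈ X, ∀ j ∉ X, a i ≠ a j) ∧ x ≤ X.card)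
  have hne : 𝒳.Nonempty := by
    refine ⟨Finset.univ, ?_⟩
    simp only [𝒳, Finset.mem_filter, Finset.mem_univ, true_and]
    refine ⟨by simp, ?_⟩
    rw [Finset.card_univ]; linarith
  obtain ⟨X, hX, hmin⟩ := Finset.exists_min_image 𝒳 Finset.card hne
  simp only [𝒳, Finset.mem_filter, Finset.mem_univ, true_and] at hX hmin
  refine ⟨X, hX.1, hX.2, ?_⟩
  have hcompl : ((Xᶜ).card : ℝ) = Fintype.card ι - X.card := by
    rw [Finset.card_compl, Nat.cast_sub (Finset.card_le_univ X)]
  rw [hcompl]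
  have hXne : X.Nonempty := by
    rw [← Finset.card_pos]
    have : (0 : ℝ) < X.card := lt_of_lt_of_le hx0 hX.2
    exact_mod_cast this
  obtain ⟨u, hu⟩ := hXne
  set C := Finset.univ.filter (fun i => a i = a u) with hC
  have hCX : C ⊆ X := by
    intro i hi
    by_contra hiX
    exact hX.1 u hu i hiX (by simpa [hC] using (Finset.mem_filter.1 hi).2.symm)
  by_cases hEq : C = X
  · have := h (a u)
    rw [← hC, hEq] at this
    linarith
  have hlt : C.card < X.card := Finset.card_lt_card (lt_of_le_of_ne hCX hEq)
  have hCpos : 0 < C.card := Finset.card_pos.2 ⟨u, by simp [hC]⟩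
  have h1 : (C.card : ℝ) < x := by
    by_contra hc
    have := hmin C ⟨?_, not_lt.1 hc⟩
    · omega
    · intro i hi j hj
      simp only [hC, Finset.mem_filter, Finset.mem_univ, true_and] at hi hj
      rw [hi]; exact fun e => hj e.symm
  have hsd : (X \ C).card + C.card = X.card := Finset.card_sdiff_add_card_eq_card hCX
  have h2 : ((X \ C).card : ℝ) < x := by
    by_contra hc
    have := hmin (X \ C) ⟨?_, not_lt.1 hc⟩
    · omega
    · intro i hi j hj hij
      simp only [Finset.mem_sdiff, not_and, not_not] at hi hj
      by_cases hjX : j ∈ X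
      · have := hj hjX
        simp only [hC, Finset.mem_filter, Finset.mem_univ, true_and] at this hi
        exact hi.2 (hij.trans this)
      · exact hX.1 i hi.1 j hjX hij
  have h3 : (X.card : ℝ) = (X \ C).card + C.card := by exact_mod_cast hsd.symm
  linarith

/-- If any two large disjoint sets are joined by an edge, and any two adjacent vertices agree under
`a` or under `b`, then `a` or `b` has a dominant fibre. -/
lemma exists_dominant_fibre {ι : Type*} [Fintype ι] [DecidableEq ι] (G : SimpleGraph ι)
    (a b : ι → ℝ) {x : ℝ} (hx0 : 0 < x) (hx : 6 * x ≤ Fintype.card ι)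
    (hG : ∀ A B : Finset ι, Disjoint A B → x ≤ A.card → x ≤ B.card → ∃ u ∈ A, ∃ v ∈ B, G.Adj u v)
    (hab : ∀ u v, G.Adj u v → a u = a v ∨ b u = b v) :
    (∃ c, (Fintype.card ι - 2 * x : ℝ) < (Finset.univ.filter (fun i => a i = c)).card) ∨
    (∃ c, (Fintype.card ι - 2 * x : ℝ) < (Finset.univ.filter (fun i => b i = c)).card) := by
  by_contra hcon
  push Not at hcon
  obtain ⟨ha, hb⟩ := hcon
  obtain ⟨X, hX, hX1, hX2⟩ := exists_balanced_cut a (by linarith : 0 < 2 * x) (by linarith) ha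
  obtain ⟨Y, hY, hY1, hY2⟩ := exists_balanced_cut b (by linarith : 0 < 2 * x) (by linarith) hb
  -- An edge between opposite corners of the two cuts would cross both cuts, so its ends would agree
  -- under neither function.
  have no1 : ¬ (x ≤ (X ∩ Y).card ∧ x ≤ (Xᶜ ∩ Yᶜ).card) := by
    rintro ⟨h1, h2⟩
    obtain ⟨u, hu, v, hv, huv⟩ := hG (X ∩ Y) (Xᶜ ∩ Yᶜ)
      (Finset.disjoint_left.2 fun z hz hz' => by simp at hz hz'; exact hz'.1 hz.1) h1 h2
    simp at hu hv
    rcases hab u v huv with h | h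
    · exact hX u hu.1 v hv.1 h
    · exact hY u hu.2 v hv.2 h
  have no2 : ¬ (x ≤ (X ∩ Yᶜ).card ∧ x ≤ (Xᶜ ∩ Y).card) := by
    rintro ⟨h1, h2⟩
    obtain ⟨u, hu, v, hv, huv⟩ := hG (X ∩ Yᶜ) (Xᶜ ∩ Y)
      (Finset.disjoint_left.2 fun z hz hz' => by simp at hz hz'; exact hz'.1 hz.1) h1 h2
    simp at hu hv
    rcases hab u v huv with h | h
    · exact hX u hu.1 v hv.1 h
    · exact hY v hv.2 u hu.2 h.symm
  have split : ∀ P Q : Finset ι, (P.card : ℝ) = (P ∩ Q).card + (P ∩ Qᶜ).card := by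
    intro P Q
    have := Finset.card_inter_add_card_sdiff P Q
    rw [Finset.sdiff_eq_inter_compl] at this
    exact_mod_cast this.symm
  have e1 := split X Y
  have e2 := split Xᶜ Y
  have e3 := split Y X
  have e4 := split Yᶜ X
  rw [Finset.inter_comm Y X, Finset.inter_comm Y Xᶜ] at e3
  rw [Finset.inter_comm Yᶜ X, Finset.inter_comm Yᶜ Xᶜ] at e4
  have d1 : ((X ∩ Y).card : ℝ) < x ∨ ((Xᶜ ∩ Yᶜ).card : ℝ) < x := by
    by_contra h; push Not at h; exact no1 h
  have d2 : ((X ∩ Yᶜ).card : ℝ) < x ∨ ((Xᶜ ∩ Y).card : ℝ) < x := by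
    by_contra h; push Not at h; exact no2 h
  -- One small corner from each diagonal always gives two corners making up one of `X`, `Xᶜ`, `Y`,
  -- `Yᶜ`, which would then have fewer than `2 * x` elements.
  rcases d1 with d1 | d1 <;> rcases d2 with d2 | d2 <;> linarith

/-- The properties of a graph of known distances from which reconstruction is deduced: large
disjoint sets are joined, small sets are sparse, and the vertices of low degree, collected in `S`,
are far apart from each other. -/
structure Pseudorandom (V : Finset ℝ) (G : SimpleGraph V) (S : Set V) (x d : ℝ) : Prop where
  joined : ∀ A B : Finset V, Disjoint A B → x ≤ A.card → x ≤ B.card →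
    ∃ u ∈ A, ∃ v ∈ B, G.Adj u v
  sparse : ∀ L : Finset V, L.Nonempty → (L.card : ℝ) ≤ 2 * x →
    ∃ u ∈ L, ((G.neighborSet u ∩ L).ncard : ℝ) ≤ d
  degree : ∀ u ∉ S, d + 2 < (G.neighborSet u).ncard
  not_adj : ∀ u ∈ S, ∀ w ∈ S, ¬ G.Adj u w
  no_common : ∀ u ∈ S, ∀ w ∈ S, u ≠ w → ∀ v, ¬ (G.Adj u v ∧ G.Adj v w)
  no_reflection : ∀ u ∈ S, ∀ w ∈ S, ∀ v, G.Adj u v → (w : ℝ) ≠ 2 * v - u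

/-- A moved point goes to `2 * v - u` for each fixed neighbour `v`, so it has at most one of these.
This bounds the degree of some moved point outside `S`, if any exists, by `d + 2`. Once only points
of `S` move, their neighbours are all fixed, and security together with injectivity blocks the one
remaining reflection. -/
lemma eq_self_of_pseudorandom {V : Finset ℝ} {G : SimpleGraph V} {S : Set V} {x d : ℝ}
    (hG : Pseudorandom V G S x d) (hN : NoIsolatedNoUndecidable V G) {f : V → ℝ}
    (hf : Function.Injective f)
    (hd : ∀ u v : V, G.Adj u v → dist (f u) (f v) = dist (u : ℝ) (v : ℝ))
    (hbig : (Fintype.card V - 2 * x : ℝ) < (Finset.univ.filter (fun u : V => f u = u)).card) :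
    ∀ u, f u = u := by
  classical
  have refl : ∀ u v, G.Adj u v → f u ≠ u → f v = v → f u = 2 * v - u := by
    intro u v huv hu hv
    have := hd u v huv
    rw [Real.dist_eq, Real.dist_eq, hv, abs_eq_abs] at this
    rcases this with h | h
    · exact absurd (by linarith) hu
    · linarith
  have atMostOne : ∀ u v w, G.Adj u v → G.Adj u w → f u ≠ u → f v = v → f w = w → v = w := by
    intro u v w huv huw hu hv hw
    have h1 := refl u v huv hu hv
    have h2 := refl u w huw hu hw
    exact Subtype.ext (by linarith)
  set L : Finset V := Finset.univ.filter (fun u => f u ≠ u ∧ u ∉ S) with hL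
  have hLsmall : (L.card : ℝ) ≤ 2 * x := by
    have h1 : L.card ≤ (Finset.univ.filter (fun u : V => ¬ f u = u)).card :=
      Finset.card_le_card fun u hu => by simp [hL] at hu ⊢; exact hu.1
    have h2 := Finset.card_filter_add_card_filter_not (s := (Finset.univ : Finset V))
      (fun u : V => f u = u)
    rw [Finset.card_univ] at h2
    have h3 : ((Finset.univ.filter (fun u : V => f u = u)).card : ℝ) +
      (Finset.univ.filter (fun u : V => ¬ f u = u)).card = Fintype.card V := by exact_mod_cast h2
    have h4 : (L.card : ℝ) ≤ (Finset.univ.filter (fun u : V => ¬ f u = u)).card := by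
      exact_mod_cast h1
    linarith
  have hLempty : L = ∅ := by
    by_contra hne
    obtain ⟨u, hu, hcard⟩ := hG.sparse L (Finset.nonempty_iff_ne_empty.2 hne) hLsmall
    simp only [hL, Finset.mem_filter, Finset.mem_univ, true_and] at hu
    have hdeg := hG.degree u hu.2
    -- Neighbours outside `L` are fixed or in `S`. There is at most one of each kind, the second
    -- because points of `S` have no common neighbour; this accounts for the `+ 2` in the degree
    -- condition.
    have hsub : G.neighborSet u ⊆ (G.neighborSet u ∩ L) ∪
        ({v | G.Adj u v ∧ f v = v} ∪ {v | G.Adj u v ∧ v ∈ S}) := by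
      intro v hv
      have hv' : G.Adj u v := hv
      by_cases h1 : f v = v
      · exact Or.inr (Or.inl ⟨hv', h1⟩)
      by_cases h2 : v ∈ S
      · exact Or.inr (Or.inr ⟨hv', h2⟩)
      exact Or.inl ⟨hv, by simp [hL, h1, h2]⟩
    have c1 : {v | G.Adj u v ∧ f v = v}.ncard ≤ 1 := by
      rw [Set.ncard_le_one_iff]
      intro v w hv hw
      exact atMostOne u v w hv.1 hw.1 hu.1 hv.2 hw.2
    have c2 : {v | G.Adj u v ∧ v ∈ S}.ncard ≤ 1 := by
      rw [Set.ncard_le_one_iff]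
      intro v w hv hw
      by_contra hvw
      exact hG.no_common v hv.2 w hw.2 hvw u ⟨hv.1.symm, hw.1⟩
    have c3 := (Set.ncard_le_ncard hsub (Set.toFinite _)).trans
      ((Set.ncard_union_le _ _).trans (Nat.add_le_add_left (Set.ncard_union_le _ _) _))
    have c4 : (G.neighborSet u).ncard ≤ (G.neighborSet u ∩ L).ncard + 2 := by omega
    have c5 : ((G.neighborSet u).ncard : ℝ) ≤ (G.neighborSet u ∩ L).ncard + 2 := by
      exact_mod_cast c4
    linarith
  have hS : ∀ u, f u ≠ u → u ∈ S := by
    intro u hu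
    by_contra hS
    have : u ∈ L := by simp [hL, hu, hS]
    simp [hLempty] at this
  intro u
  by_contra hu
  obtain ⟨v, hv⟩ := hN.1 u
  have hv' : G.Adj u v := hv
  have fix : ∀ w, G.Adj u w → f w = w := fun w hw => by
    by_contra h
    exact hG.not_adj u (hS u hu) w (hS w h) hw
  have hsing : G.neighborSet u = {v} := by
    ext w
    refine ⟨fun hw => ?_, fun hw => ?_⟩
    · exact atMostOne u w v hw hv' hu (fix w hw) (fix v hv')
    · rw [Set.mem_singleton_iff.1 hw]; exact hv
  obtain ⟨-, hmem⟩ := hN.2 u v hsing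
  have hfu := refl u v hv' hu (fix v hv')
  -- The target of the reflection is a point of `V`. If it is fixed, then two points share an image;
  -- if it is moved, it lies in `S`, against `no_reflection`.
  by_cases hw : f ⟨_, hmem⟩ = 2 * (v : ℝ) - u
  · have := hf (hfu.trans hw.symm)
    exact hu (hfu.trans (congrArg Subtype.val this).symm)
  · exact hG.no_reflection u (hS u hu) ⟨_, hmem⟩ (hS _ hw) v hv' rfl

/-- A dominant fibre of `f - id` means that `f` is nearly a translation, and one of `f + id` that it
is nearly a reflection. Undoing that isometry leaves a map fixing most points. -/
theorem reconstructible_of_pseudorandom {V : Finset ℝ} {G : SimpleGraph V} {S : Set V} {x d : ℝ}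
    (hx0 : 0 < x) (hx : 6 * x ≤ Fintype.card V)
    (hG : Pseudorandom V G S x d) (hN : NoIsolatedNoUndecidable V G) : Reconstructible V G := by
  classical
  intro f hf hd
  rcases exists_dominant_fibre G (fun u => f u - u) (fun u => f u + u) hx0 hx hG.joined
    (fun u v huv => by
      have := hd u v huv
      rw [Real.dist_eq, Real.dist_eq, abs_eq_abs] at this
      rcases this with h | h
      · left; linarith
      · right; linarith) with ⟨c, hc⟩ | ⟨c, hc⟩
  · refine ⟨IsometryEquiv.addRight c, fun u => ?_⟩
    have := eq_self_of_pseudorandom hG hN (f := fun u => f u - c)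
      (fun a b h => hf (by simpa using h))
      (fun u v huv => by rw [← hd u v huv]; simp) (by
        rwa [Finset.filter_congr (q := fun v : V => f v - v = c)
          (fun v _ => ⟨fun h => by linarith, fun h => by linarith⟩)]) u
    simp only [IsometryEquiv.addRight_apply]
    linarith
  · refine ⟨IsometryEquiv.subLeft c, fun u => ?_⟩
    have := eq_self_of_pseudorandom hG hN (f := fun u => c - f u)
      (fun a b h => hf (by simpa using h))
      (fun u v huv => by rw [← hd u v huv]; exact dist_sub_left c _ _) (by
        rwa [Finset.filter_congr (q := fun v : V => f v + v = c)
          (fun v _ => ⟨fun h => by linarith, fun h => by linarith⟩)]) u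
    simp only [IsometryEquiv.subLeft_apply]
    linarith

/-- Only one point is displaced. Comparison with a third point, which stays in place, shows that the
new placement does not come from an isometry. -/
theorem noIsolatedNoUndecidable_of_reconstructible {V : Finset ℝ} {G : SimpleGraph V}
    (hV : 3 ≤ V.card) (hG : Reconstructible V G) : NoIsolatedNoUndecidable V G := by
  classical
  have hcard : Fintype.card V = V.card := Fintype.card_coe V
  have third : ∀ u v : V, ∃ w : V, w ≠ u ∧ w ≠ v := by
    intro u v
    by_contra h
    push Not at h
    have h1 : (Finset.univ : Finset V) ⊆ {u, v} := by
      intro w _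
      by_cases hw : w = u
      · simp [hw]
      · simp [h w hw]
    have h2 := (Finset.card_le_card h1).trans Finset.card_le_two
    rw [Finset.card_univ] at h2
    omega
  have inj : ∀ (u : V) (y : ℝ), y ∉ V → Function.Injective (Function.update (fun v : V => (v : ℝ)) u y) := by
    intro u y hy a b hab
    by_cases ha : a = u <;> by_cases hb : b = u
    · rw [ha, hb]
    · subst ha; rw [Function.update_self, Function.update_of_ne hb] at hab
      exact absurd (hab ▸ b.2) hy
    · subst hb; rw [Function.update_self, Function.update_of_ne ha] at hab
      exact absurd (hab ▸ a.2) hy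
    · rw [Function.update_of_ne ha, Function.update_of_ne hb] at hab
      exact Subtype.ext hab
  -- All points but `u` stay in place, so an isometry realising the displacement fixes `v`, and
  -- hence can take `u` only to `u` or to its reflection over `v`.
  have move : ∀ (u v : V) (y : ℝ), v ≠ u → y ∉ V →
      (∀ w, G.Adj u w → dist y (w : ℝ) = dist (u : ℝ) w) →
      (y = u ∨ y = 2 * v - u) := by
    intro u v y hvu hy hdist
    obtain ⟨g, hg⟩ := hG (Function.update (fun v : V => (v : ℝ)) u y) (inj u y hy) (by
      intro a b hab
      by_cases ha : a = u
      · subst ha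
        rw [Function.update_self, Function.update_of_ne hab.ne']
        exact hdist b hab
      · by_cases hb : b = u
        · subst hb
          rw [Function.update_self, Function.update_of_ne ha, dist_comm, hdist a hab.symm,
            dist_comm]
        · rw [Function.update_of_ne ha, Function.update_of_ne hb])
    have h1 := hg u
    have h2 := hg v
    rw [Function.update_self] at h1
    rw [Function.update_of_ne hvu] at h2
    have h3 := g.isometry.dist_eq (u : ℝ) v
    rw [← h1, ← h2, Real.dist_eq, Real.dist_eq, abs_eq_abs] at h3
    rcases h3 with h | h
    · left; linarith
    · right; linarith
  refine ⟨fun u => ?_, fun u v huv => ?_⟩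
  · by_contra hne
    rw [Set.not_nonempty_iff_eq_empty] at hne
    obtain ⟨v, hv, -⟩ := third u u
    obtain ⟨y, hy⟩ := Infinite.exists_notMem_finset (insert (2 * (v : ℝ) - u) V)
    rw [Finset.mem_insert, not_or] at hy
    rcases move u v y hv hy.2 (fun w hw => by
      have : w ∈ G.neighborSet u := hw
      simp [hne] at this) with h | h
    · exact hy.2 (h ▸ u.2)
    · exact hy.1 h
  · have hadj : G.Adj u v := by
      have : v ∈ G.neighborSet u := by rw [huv]; rfl
      exact this
    refine ⟨hadj.ne, ?_⟩
    by_contra hmem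
    -- The point `u` is sent to `2 * v - u`. Tested against `w`, this would have to be `u`, which is
    -- in `V`, or `2 * w - u`, which forces `w = v`.
    obtain ⟨w, hwu, hwv⟩ := third u v
    rcases move u w _ hwu hmem (fun z hz => by
      have : z ∈ G.neighborSet u := hz
      rw [huv, Set.mem_singleton_iff] at this
      subst this
      rw [Real.dist_eq, Real.dist_eq, abs_eq_abs]
      right; ring) with h | h
    · exact hmem (by rw [h]; exact u.2)
    · exact hwv (Subtype.ext (by linarith))

end Deterministic
-- Tail bounds for revealed pairs; joinedness and sparsity.
section Events
variable {V : Finset ℝ}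

lemma card_edgeSet_top (V : Finset ℝ) :
    Fintype.card (⊤ : SimpleGraph V).edgeSet = V.card.choose 2 := by
  rw [← SimpleGraph.edgeFinset_card, SimpleGraph.card_edgeFinset_top_eq_card_choose_two,
    Fintype.card_coe]

instance (V : Finset ℝ) : Nonempty (RevealOrder V) :=
  ⟨(Fintype.equivFinOfCardEq (card_edgeSet_top V)).symm⟩

lemma mem_edgeSet_revealedGraph (σ : RevealOrder V) (t : ℕ) (e : (⊤ : SimpleGraph V).edgeSet) :
    e.1 ∈ (revealedGraph σ t).edgeSet ↔ (σ.symm e : ℕ) < t := by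
  have he : e.1 ∉ Sym2.diagSet := by
    have := e.2
    simpa using this
  simp only [revealedGraph, SimpleGraph.edgeSet_fromEdgeSet, Set.mem_sdiff, Set.mem_ofPred_eq]
  constructor
  · rintro ⟨⟨i, hi, h⟩, -⟩
    rw [← Subtype.ext h]
    simpa using hi
  · intro h
    exact ⟨⟨σ.symm e, h, by simp⟩, he⟩

lemma revealedGraph_mono (σ : RevealOrder V) {s t : ℕ} (h : s ≤ t) :
    revealedGraph σ s ≤ revealedGraph σ t := by
  unfold revealedGraph
  refine SimpleGraph.fromEdgeSet_mono ?_
  rintro e ⟨i, hi, h'⟩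
  exact ⟨i, hi.trans_le h, h'⟩

/-- The pairs of distinct points which belong to `T`. -/
noncomputable def edgesOf (T : Finset (Sym2 V)) : Finset (⊤ : SimpleGraph V).edgeSet :=
  Finset.univ.filter (fun e => e.1 ∈ T)

lemma mem_edgesOf {T : Finset (Sym2 V)} {e : (⊤ : SimpleGraph V).edgeSet} :
    e ∈ edgesOf T ↔ e.1 ∈ T := by
  simp [edgesOf]

lemma card_edgesOf {T : Finset (Sym2 V)} (hT : ∀ e ∈ T, ¬ e.IsDiag) :
    (edgesOf T).card = T.card := by
  rw [← Finset.card_map (Function.Embedding.subtype _)]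
  congr 1
  ext e
  simp only [Finset.mem_map, mem_edgesOf, Function.Embedding.subtype_apply]
  constructor
  · rintro ⟨e, he, rfl⟩; exact he
  · intro he
    exact ⟨⟨e, by simpa using hT e he⟩, he, rfl⟩

open Classical in
lemma card_filter_edgesOf (T : Finset (Sym2 V)) (σ : RevealOrder V) (t : ℕ) :
    ((edgesOf T).filter (fun e => (σ.symm e : ℕ) < t)).card
      = (T.filter (· ∈ (revealedGraph σ t).edgeSet)).card := by
  rw [← Finset.card_map (Function.Embedding.subtype _)]
  congr 1
  ext e
  simp only [Finset.mem_map, mem_edgesOf, Function.Embedding.subtype_apply, Finset.mem_filter,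
    ← mem_edgeSet_revealedGraph]
  constructor
  · rintro ⟨e, he, rfl⟩; exact he
  · intro he
    exact ⟨⟨e, SimpleGraph.edgeSet_mono le_top he.2⟩, he, rfl⟩

lemma forall_mem_edgesOf_iff (T : Finset (Sym2 V)) (hT : ∀ e ∈ T, ¬ e.IsDiag) (σ : RevealOrder V)
    (t : ℕ) : (∀ e ∈ edgesOf T, (σ.symm e : ℕ) < t) ↔ ∀ e ∈ T, e ∈ (revealedGraph σ t).edgeSet := by
  simp only [mem_edgesOf, ← mem_edgeSet_revealedGraph]
  exact ⟨fun h e he => h ⟨e, by simpa using hT e he⟩ he, fun h e he => h e.1 he⟩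

lemma forall_mem_edgesOf_late_iff (T : Finset (Sym2 V)) (σ : RevealOrder V)
    (t : ℕ) : (∀ e ∈ edgesOf T, t ≤ (σ.symm e : ℕ)) ↔ ∀ e ∈ T, e ∉ (revealedGraph σ t).edgeSet := by
  simp only [mem_edgesOf, ← not_lt, ← mem_edgeSet_revealedGraph]
  exact ⟨fun h e he he' => h ⟨e, SimpleGraph.edgeSet_mono le_top he'⟩ he he', fun h e he => h e.1 he⟩

lemma pr_unrevealed (T : Finset (Sym2 V)) (hT : ∀ e ∈ T, ¬ e.IsDiag) {m : ℕ}
    (hm : m ≤ V.card.choose 2) :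
    pr {σ : RevealOrder V | ∀ e ∈ T, e ∉ (revealedGraph σ m).edgeSet}
      = (V.card.choose 2 - m).descFactorial T.card / (V.card.choose 2).descFactorial T.card := by
  have := pr_late (card_edgeSet_top V) (edgesOf T) m hm
  simp only [forall_mem_edgesOf_late_iff, card_edgesOf hT] at this
  exact this

lemma pr_unrevealed_le (T : Finset (Sym2 V)) (hT : ∀ e ∈ T, ¬ e.IsDiag) {m : ℕ}
    (hm : m ≤ V.card.choose 2) :
    pr {σ : RevealOrder V | ∀ e ∈ T, e ∉ (revealedGraph σ m).edgeSet}
      ≤ Real.exp (-((m : ℝ) / V.card.choose 2 * T.card)) := by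
  rw [pr_unrevealed T hT hm]
  have hT' : T.card ≤ V.card.choose 2 := by
    rw [← card_edgesOf hT, ← card_edgeSet_top V]; exact Finset.card_le_univ _
  refine (descFactorial_div_le (Nat.sub_le _ _) hT').trans ?_
  have h1 : ((V.card.choose 2 - m : ℕ) : ℝ) / V.card.choose 2
      ≤ Real.exp (-((m : ℝ) / V.card.choose 2)) := by
    rcases Nat.eq_zero_or_pos (V.card.choose 2) with h | h
    · simp [h]
    · have h' : (V.card.choose 2 : ℝ) ≠ 0 := by exact_mod_cast h.ne'
      rw [Nat.cast_sub hm, sub_div, div_self h']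
      linarith [Real.add_one_le_exp (-((m : ℝ) / V.card.choose 2))]
  refine (pow_le_pow_left₀ (by positivity) h1 _).trans (le_of_eq ?_)
  rw [← Real.exp_nat_mul]; congr 1; ring

open Classical in
/-- Chernoff bound for the event that all of `F` is revealed at time `m₂` and few of the pairs in
`D` are revealed at time `m₁`. -/
lemma pr_lower_tail_le (F D : Finset (Sym2 V)) (hF : ∀ e ∈ F, ¬ e.IsDiag)
    (hD : ∀ e ∈ D, ¬ e.IsDiag) (hd : Disjoint F D) {m₁ m₂ : ℕ} (hm₁ : m₁ ≤ V.card.choose 2)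
    (hm₂ : m₂ ≤ V.card.choose 2) (hFm : F.card ≤ m₁) (hFN : F.card < V.card.choose 2)
    (k : ℝ) {s : ℝ} (hs0 : 0 < s) (hs1 : s ≤ 1) :
    pr {σ : RevealOrder V | (∀ e ∈ F, e ∈ (revealedGraph σ m₂).edgeSet) ∧
        ((D.filter (· ∈ (revealedGraph σ m₁).edgeSet)).card : ℝ) ≤ k}
      ≤ ((m₂ : ℝ) / V.card.choose 2) ^ F.card *
        Real.exp (-Real.log s * k -
          (1 - s) * (((m₁ : ℝ) - F.card) / V.card.choose 2) * D.card) := by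
  set N := V.card.choose 2 with hNdef
  have hmom := avg_lower_moment_le (card_edgeSet_top V) (edgesOf F) (edgesOf D)
    (Finset.disjoint_left.2 fun e h1 h2 =>
      Finset.disjoint_left.1 hd (mem_edgesOf.1 h1) (mem_edgesOf.1 h2))
    m₁ m₂ hm₁ hm₂ (by rwa [card_edgesOf hF]) hs0.le hs1
  simp only [forall_mem_edgesOf_iff F hF, card_filter_edgesOf, card_edgesOf hF,
    card_edgesOf hD, ← hNdef] at hmom
  have hNpos : (0 : ℝ) < N := by exact_mod_cast (Nat.zero_le _).trans_lt hFN
  -- The late ratio is `1 - (m₁ - F.card) / (N - F.card)`. Enlarging the denominator to `N` and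
  -- using `1 + y ≤ exp y` gives the exponential.
  have hq : (1 - s) * (((N - m₁ : ℕ) : ℝ) / (N - F.card : ℕ)) + s
      ≤ Real.exp (-((1 - s) * (((m₁ : ℝ) - F.card) / N))) := by
    rw [Nat.cast_sub hm₁, Nat.cast_sub hFN.le]
    have h1 : (0 : ℝ) < N - F.card := by
      have : (F.card : ℝ) < N := by exact_mod_cast hFN
      linarith
    have h0 : (0 : ℝ) ≤ m₁ - F.card := by
      have : (F.card : ℝ) ≤ m₁ := by exact_mod_cast hFm
      linarith
    have h2 : ((N : ℝ) - m₁) / (N - F.card) = 1 - (m₁ - F.card) / (N - F.card) := by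
      field_simp; ring
    have h3 : ((m₁ : ℝ) - F.card) / N ≤ (m₁ - F.card) / (N - F.card) :=
      div_le_div_of_nonneg_left h0 h1 (by have : (0 : ℝ) ≤ F.card := by positivity
                                          linarith)
    have h4 := Real.add_one_le_exp (-((1 - s) * (((m₁ : ℝ) - F.card) / N)))
    rw [h2]
    have h5 := mul_le_mul_of_nonneg_left h3 (by linarith : (0 : ℝ) ≤ 1 - s)
    linarith
  have hq0 : 0 ≤ (1 - s) * (((N - m₁ : ℕ) : ℝ) / (N - F.card : ℕ)) + s := by
    have : 0 ≤ 1 - s := by linarith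
    positivity
  have hpow := pow_le_pow_left₀ hq0 hq D.card
  have hsk : ∀ j : ℕ, (j : ℝ) ≤ k → 1 ≤ Real.exp (-Real.log s * k) * s ^ j := by
    intro j hj
    rw [← Real.exp_log hs0, ← Real.exp_nat_mul, ← Real.exp_add, Real.exp_log hs0]
    refine Real.one_le_exp ?_
    have : Real.log s ≤ 0 := Real.log_nonpos hs0.le hs1
    nlinarith
  refine (pr_le_avg (g := fun σ => Real.exp (-Real.log s * k) *
    ({σ : RevealOrder V | ∀ e ∈ F, e ∈ (revealedGraph σ m₂).edgeSet}.indicator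
        (fun _ => (1 : ℝ)) σ * s ^ (D.filter (· ∈ (revealedGraph σ m₁).edgeSet)).card))
    (fun σ => ?_) (fun σ hσ => ?_)).trans ?_
  · refine mul_nonneg (Real.exp_nonneg _) (mul_nonneg ?_ (pow_nonneg hs0.le _))
    exact Set.indicator_nonneg (fun _ _ => zero_le_one) σ
  · rw [Set.indicator_of_mem (by exact hσ.1), one_mul]
    exact hsk _ hσ.2
  · rw [avg_mul_left]
    refine (mul_le_mul_of_nonneg_left hmom (Real.exp_nonneg _)).trans ?_
    rw [sub_eq_add_neg (-Real.log s * k), Real.exp_add, mul_left_comm]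
    refine mul_le_mul_of_nonneg_left ?_ (by positivity)
    refine mul_le_mul_of_nonneg_left (hpow.trans (le_of_eq ?_)) (Real.exp_nonneg _)
    rw [← Real.exp_nat_mul]; congr 1; ring

open Classical in
/-- Chernoff bound for the event that many of the pairs in `D` are revealed. -/
lemma pr_upper_tail_le (D : Finset (Sym2 V)) (hD : ∀ e ∈ D, ¬ e.IsDiag) {m : ℕ}
    (hm : m ≤ V.card.choose 2) (k : ℝ) {θ : ℝ} (hθ : 0 ≤ θ) :
    pr {σ : RevealOrder V | k ≤ ((D.filter (· ∈ (revealedGraph σ m).edgeSet)).card : ℝ)}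
      ≤ Real.exp (Real.exp θ * ((m : ℝ) / V.card.choose 2) * D.card - θ * k) := by
  set N := V.card.choose 2 with hNdef
  have hmom := avg_upper_moment_le (card_edgeSet_top V) (edgesOf D) m hm (Real.one_le_exp hθ)
  simp only [card_filter_edgesOf, card_edgesOf hD, ← hNdef] at hmom
  refine (pr_le_avg (g := fun σ => Real.exp (-(θ * k)) *
    (Real.exp θ ^ (D.filter (· ∈ (revealedGraph σ m).edgeSet)).card))
    (fun σ => by positivity) (fun σ hσ => ?_)).trans ?_
  · rw [← Real.exp_nat_mul, ← Real.exp_add]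
    refine Real.one_le_exp ?_
    have : k ≤ _ := hσ
    nlinarith
  · rw [avg_mul_left]
    refine (mul_le_mul_of_nonneg_left hmom (Real.exp_nonneg _)).trans ?_
    rw [sub_eq_add_neg _ (θ * k), Real.exp_add, mul_comm]
    refine mul_le_mul_of_nonneg_right ?_ (Real.exp_nonneg _)
    have h0 : (0 : ℝ) ≤ (m : ℝ) / N := by positivity
    have h1 : (Real.exp θ - 1) * ((m : ℝ) / N) + 1 ≤ Real.exp (Real.exp θ * ((m : ℝ) / N)) := by
      have := Real.add_one_le_exp (Real.exp θ * ((m : ℝ) / N))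
      linarith
    have h2 : 0 ≤ (Real.exp θ - 1) * ((m : ℝ) / N) + 1 := by
      have := Real.one_le_exp hθ
      have : 0 ≤ (Real.exp θ - 1) * ((m : ℝ) / N) := mul_nonneg (by linarith) h0
      linarith
    refine (pow_le_pow_left₀ h2 h1 _).trans (le_of_eq ?_)
    rw [← Real.exp_nat_mul]; congr 1; ring

/-- Large disjoint sets are joined by a revealed pair, with high probability. -/
lemma pr_not_joined_le {m : ℕ} (hm : m ≤ V.card.choose 2) {x : ℝ} (hx : 0 ≤ x) :
    pr {σ : RevealOrder V | ∃ A B : Finset V, Disjoint A B ∧ x ≤ A.card ∧ x ≤ B.card ∧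
      ∀ u ∈ A, ∀ v ∈ B, ¬ (revealedGraph σ m).Adj u v}
      ≤ 4 ^ V.card * Real.exp (-((m : ℝ) / V.card.choose 2 * x ^ 2)) := by
  classical
  set Q : Finset (Finset V × Finset V) := Finset.univ.filter
    (fun P => Disjoint P.1 P.2 ∧ x ≤ P.1.card ∧ x ≤ P.2.card) with hQ
  refine (pr_iUnion_le Q
    (fun P => {σ | ∀ u ∈ P.1, ∀ v ∈ P.2, ¬ (revealedGraph σ m).Adj u v}) ?_).trans ?_
  · rintro σ ⟨A, B, h1, h2, h3, h4⟩
    exact ⟨(A, B), by simp [hQ, h1, h2, h3], h4⟩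
  have hcard : (Q.card : ℝ) ≤ 4 ^ V.card := by
    have h1 := Finset.card_filter_le (Finset.univ : Finset (Finset V × Finset V))
      (fun P => Disjoint P.1 P.2 ∧ x ≤ P.1.card ∧ x ≤ P.2.card)
    rw [Finset.card_univ, Fintype.card_prod, Fintype.card_finset, Fintype.card_coe,
      ← mul_pow] at h1
    exact_mod_cast h1
  refine (Finset.sum_le_card_nsmul Q _
    (Real.exp (-((m : ℝ) / V.card.choose 2 * x ^ 2))) fun P hP => ?_).trans ?_
  · simp only [hQ, Finset.mem_filter, Finset.mem_univ, true_and] at hP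
    set T := (P.1 ×ˢ P.2).image (fun p => s(p.1, p.2)) with hT
    have hTd : ∀ e ∈ T, ¬ e.IsDiag := by
      intro e he
      simp only [hT, Finset.mem_image, Finset.mem_product] at he
      obtain ⟨p, hp, rfl⟩ := he
      rw [Sym2.mk_isDiag_iff]
      intro h
      exact Finset.disjoint_left.1 hP.1 hp.1 (h ▸ hp.2)
    have hTc : T.card = P.1.card * P.2.card := by
      rw [hT, Finset.card_image_of_injOn, Finset.card_product]
      rintro ⟨a, b⟩ hab ⟨c, d⟩ hcd h
      simp only [Finset.coe_product, Set.mem_prod, Finset.mem_coe] at hab hcd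
      simp only [Sym2.eq_iff] at h
      rcases h with ⟨rfl, rfl⟩ | ⟨rfl, rfl⟩
      · rfl
      · exact absurd hcd.2 (Finset.disjoint_left.1 hP.1 hab.1)
    refine (pr_mono ?_).trans ((pr_unrevealed_le T hTd hm).trans ?_)
    · intro σ hσ e he
      simp only [hT, Finset.mem_image, Finset.mem_product] at he
      obtain ⟨p, hp, rfl⟩ := he
      exact hσ _ hp.1 _ hp.2
    · refine Real.exp_le_exp.2 (neg_le_neg (mul_le_mul_of_nonneg_left ?_ (by positivity)))
      rw [hTc, pow_two]
      push_cast
      exact mul_le_mul hP.2.1 hP.2.2 hx (by positivity)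
  · rw [nsmul_eq_mul]
    exact mul_le_mul_of_nonneg_right hcard (Real.exp_nonneg _)

/-- Small sets span few revealed pairs, with high probability. -/
lemma pr_not_sparse_le {m : ℕ} (hm : m ≤ V.card.choose 2) {y d θ : ℝ} (hθ : 0 ≤ θ) :
    pr {σ : RevealOrder V | ∃ L : Finset V, L.Nonempty ∧ (L.card : ℝ) ≤ y ∧
      ∀ u ∈ L, d < (((revealedGraph σ m).neighborSet u ∩ L).ncard : ℝ)}
      ≤ Real.exp (V.card *
        Real.exp (Real.exp θ * ((m : ℝ) / V.card.choose 2) * y - θ * (d / 2))) - 1 := by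
  classical
  set r := Real.exp (Real.exp θ * ((m : ℝ) / V.card.choose 2) * y - θ * (d / 2)) with hr
  set Q : Finset (Finset V) := Finset.univ.filter (fun L => L.Nonempty ∧ (L.card : ℝ) ≤ y) with hQ
  refine (pr_iUnion_le Q (fun L => {σ | ∀ u ∈ L,
    d < (((revealedGraph σ m).neighborSet u ∩ L).ncard : ℝ)}) ?_).trans ?_
  · rintro σ ⟨L, h1, h2, h3⟩
    exact ⟨L, by simp [hQ, h1, h2], h3⟩
  -- If all degrees inside `L` exceed `d`, then `L` spans at least `d / 2 * L.card` revealed pairs.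
  -- At most `L.card * y` pairs are available, so the Chernoff bound is a power with exponent
  -- `L.card` and base `r` independent of `L`.
  have hL : ∀ L ∈ Q, pr {σ : RevealOrder V | ∀ u ∈ L,
      d < (((revealedGraph σ m).neighborSet u ∩ L).ncard : ℝ)} ≤ r ^ L.card := by
    intro L hL
    simp only [hQ, Finset.mem_filter, Finset.mem_univ, true_and] at hL
    set D := L.offDiag.image (fun p => s(p.1, p.2)) with hD
    have hDd : ∀ e ∈ D, ¬ e.IsDiag := by
      intro e he
      simp only [hD, Finset.mem_image, Finset.mem_offDiag] at he
      obtain ⟨p, hp, rfl⟩ := he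
      rw [Sym2.mk_isDiag_iff]
      exact hp.2.2
    have hDc : (D.card : ℝ) ≤ L.card * L.card := by
      have h1 : D.card ≤ L.offDiag.card := Finset.card_image_le
      rw [Finset.offDiag_card] at h1
      exact_mod_cast h1.trans (Nat.sub_le _ _)
    refine (pr_mono ?_).trans ((pr_upper_tail_le D hDd hm (d / 2 * L.card) hθ).trans ?_)
    · intro σ hσ
      simp only [Set.mem_ofPred_eq] at hσ ⊢
      set G := revealedGraph σ m
      set P : Finset (V × V) := L.offDiag.filter (fun p => G.Adj p.1 p.2) with hP
      have h1 : P.card ≤ 2 * (D.filter (· ∈ G.edgeSet)).card := by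
        refine Finset.card_le_mul_card_image_of_maps_to (f := fun p : V × V => s(p.1, p.2)) ?_ 2 ?_
        · intro p hp
          rw [hP, Finset.mem_filter] at hp
          exact Finset.mem_filter.2 ⟨Finset.mem_image_of_mem _ hp.1, hp.2⟩
        · intro e he
          induction e using Sym2.ind with
          | _ a b =>
            refine (Finset.card_le_card (t := {(a, b), (b, a)}) ?_).trans Finset.card_le_two
            rintro ⟨c, d⟩ hcd
            have := (Finset.mem_filter.1 hcd).2
            simp only [Sym2.eq_iff] at this
            rcases this with ⟨rfl, rfl⟩ | ⟨rfl, rfl⟩ <;> simp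
      have h2 : P.card = ∑ u ∈ L, (G.neighborSet u ∩ L).ncard := by
        rw [Finset.card_eq_sum_card_fiberwise (f := Prod.fst) (t := L)]
        · refine Finset.sum_congr rfl fun u hu => ?_
          rw [← Set.ncard_coe_finset]
          refine Set.ncard_congr (fun p _ => p.2) ?_ ?_ ?_
          · rintro ⟨a, b⟩ hab
            simp [hP] at hab ⊢
            obtain ⟨⟨h, h'⟩, rfl⟩ := hab
            exact ⟨h', h.2.1⟩
          · rintro ⟨a, b⟩ ⟨c, d⟩ hab hcd h
            simp [hP] at hab hcd h
            rw [hab.2, hcd.2, h]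
          · rintro b hb
            refine ⟨(u, b), ?_, rfl⟩
            simp only [Set.mem_inter_iff, SimpleGraph.mem_neighborSet, Finset.mem_coe] at hb
            simp [hP, hu, hb.1, hb.2, hb.1.ne]
        · intro p hp
          simp only [hP, Finset.coe_filter, Set.mem_ofPred_eq, Finset.mem_offDiag] at hp
          exact hp.1.1
      have h3 : d * L.card ≤ (P.card : ℝ) := by
        rw [h2]
        push_cast
        have := Finset.card_nsmul_le_sum L (fun u => ((G.neighborSet u ∩ L).ncard : ℝ)) d
          (fun u hu => (hσ u hu).le)
        rw [nsmul_eq_mul] at this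
        linarith
      have h4 : (P.card : ℝ) ≤ 2 * (D.filter (· ∈ G.edgeSet)).card := by exact_mod_cast h1
      linarith
    · rw [hr, ← Real.exp_nat_mul]
      refine Real.exp_le_exp.2 ?_
      have h1 : Real.exp θ * ((m : ℝ) / V.card.choose 2) * D.card
          ≤ Real.exp θ * ((m : ℝ) / V.card.choose 2) * (L.card * y) :=
        mul_le_mul_of_nonneg_left
          (hDc.trans (mul_le_mul_of_nonneg_left hL.2 (by positivity))) (by positivity)
      linarith
  refine (Finset.sum_le_sum hL).trans ?_
  -- Over nonempty sets the sum is `(r + 1) ^ V.card - 1`, which is small as soon as `V.card * r`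
  -- is; discarding the empty set provides the `- 1`.
  have h1 : ∑ L ∈ Q, r ^ L.card ≤ ∑ L ∈ (Finset.univ : Finset (Finset V)).erase ∅, r ^ L.card := by
    refine Finset.sum_le_sum_of_subset_of_nonneg ?_ (fun _ _ _ => by positivity)
    intro L hL
    simp only [hQ, Finset.mem_filter, Finset.mem_univ, true_and] at hL
    simp [hL.1.ne_empty]
  have h2 := Finset.add_sum_erase (Finset.univ : Finset (Finset V)) (fun L => r ^ L.card)
    (Finset.mem_univ ∅)
  have h3 := Fintype.sum_pow_mul_eq_add_pow V r 1
  simp only [one_pow, mul_one, Fintype.card_coe] at h3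
  have h4 : (r + 1) ^ V.card ≤ Real.exp (V.card * r) := by
    rw [Real.exp_nat_mul]
    exact pow_le_pow_left₀ (by positivity) (Real.add_one_le_exp r) _
  rw [h3] at h2
  simp only [Finset.card_empty, pow_zero] at h2
  linarith

end Events
-- Points of low degree.
section Degrees
variable {V : Finset ℝ}

open Classical in
lemma card_filter_star_le (G : SimpleGraph V) (X : Finset V) (u : V) :
    ((X.image (fun w => s(u, w))).filter (· ∈ G.edgeSet)).card ≤ (G.neighborSet u).ncard := by
  refine (Finset.card_le_card (t := (X.filter (fun w => G.Adj u w)).image (fun w => s(u, w)))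
    ?_).trans (Finset.card_image_le.trans ?_)
  · intro e he
    obtain ⟨he1, he2⟩ := Finset.mem_filter.1 he
    obtain ⟨w, hw, rfl⟩ := Finset.mem_image.1 he1
    exact Finset.mem_image_of_mem _ (Finset.mem_filter.2 ⟨hw, he2⟩)
  · rw [← Set.ncard_coe_finset]
    refine Set.ncard_le_ncard (fun w hw => ?_) (Set.toFinite _)
    exact (Finset.mem_filter.1 hw).2

lemma card_star (X : Finset V) (u : V) : (X.image (fun w => s(u, w))).card = X.card :=
  Finset.card_image_of_injective _ fun _ _ h => Sym2.congr_right.1 h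

/-- Two given points both have low degree and the pairs in `F` are revealed. -/
lemma pr_low_pair_le {m₁ m₂ : ℕ} (hm₁ : m₁ ≤ V.card.choose 2) (hm₂ : m₂ ≤ V.card.choose 2)
    (h2m : 2 ≤ m₁) (h2N : 2 < V.card.choose 2) {u v w : V} (huw : u ≠ w) (F : Finset (Sym2 V))
    (hF : ∀ e ∈ F, ¬ e.IsDiag) (hF2 : F.card ≤ 2) (hFs : F ⊆ {s(u, v), s(v, w), s(u, w)}) (k : ℝ) :
    pr {σ : RevealOrder V | (∀ e ∈ F, e ∈ (revealedGraph σ m₂).edgeSet) ∧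
        (((revealedGraph σ m₁).neighborSet u).ncard : ℝ) ≤ k ∧
        (((revealedGraph σ m₁).neighborSet w).ncard : ℝ) ≤ k}
      ≤ ((m₂ : ℝ) / V.card.choose 2) ^ F.card *
        Real.exp (6 * k - (1 - Real.exp (-3)) * (((m₁ : ℝ) - 2) / V.card.choose 2) *
          (2 * (V.card - 3))) := by
  classical
  -- Dropping `u`, `v`, `w` makes the two stars disjoint from each other and from `F`, at the cost
  -- of at most three pairs per star.
  set X : Finset V := Finset.univ \ {u, v, w} with hX
  set D := X.image (fun x => s(u, x)) ∪ X.image (fun x => s(w, x)) with hD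
  have hXc : (V.card : ℝ) - 3 ≤ X.card := by
    have h1 := Finset.le_card_sdiff ({u, v, w} : Finset V) Finset.univ
    have h2 : ({u, v, w} : Finset V).card ≤ 3 := Finset.card_le_three
    rw [Finset.card_univ, Fintype.card_coe, ← hX] at h1
    have h3 : V.card ≤ X.card + 3 := by omega
    have : (V.card : ℝ) ≤ X.card + 3 := by exact_mod_cast h3
    linarith
  have hXmem : ∀ x ∈ X, x ≠ u ∧ x ≠ v ∧ x ≠ w := by
    intro x hx
    simpa [hX] using hx
  have hDc : D.card = X.card + X.card := by
    rw [hD, Finset.card_union_of_disjoint, card_star, card_star]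
    rw [Finset.disjoint_left]
    intro e h1 h2
    obtain ⟨x, hx, rfl⟩ := Finset.mem_image.1 h1
    obtain ⟨y, hy, h⟩ := Finset.mem_image.1 h2
    rw [Sym2.eq_iff] at h
    rcases h with ⟨h, -⟩ | ⟨h, -⟩
    · exact huw h.symm
    · exact (hXmem x hx).2.2 h.symm
  have hDd : ∀ e ∈ D, ¬ e.IsDiag := by
    intro e he
    rcases Finset.mem_union.1 he with he | he <;> obtain ⟨x, hx, rfl⟩ := Finset.mem_image.1 he <;>
      rw [Sym2.mk_isDiag_iff]
    · exact (hXmem x hx).1.symm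
    · exact (hXmem x hx).2.2.symm
  have hFD : Disjoint F D := by
    rw [Finset.disjoint_left]
    intro e h1 h2
    have key : ∀ x, x ∈ e → x = u ∨ x = v ∨ x = w := by
      intro x hx
      have := hFs h1
      simp only [Finset.mem_insert, Finset.mem_singleton] at this
      rcases this with rfl | rfl | rfl <;> rw [Sym2.mem_iff] at hx <;> tauto
    rcases Finset.mem_union.1 h2 with he | he <;> obtain ⟨x, hx, rfl⟩ := Finset.mem_image.1 he <;>
    · have h3 := key x (Sym2.mem_mk_right _ _)
      have h4 := hXmem x hx
      tauto
  have hs1 : Real.exp (-3) ≤ 1 := Real.exp_le_one_iff.2 (by norm_num)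
  -- The union of the stars contains at most `2 * k` revealed pairs; with `s = exp (-3)` this
  -- contributes `6 * k` to the exponent.
  refine (pr_mono ?_).trans ((pr_lower_tail_le F D hF hDd hFD hm₁ hm₂ (hF2.trans h2m)
    (hF2.trans_lt h2N) (2 * k) (Real.exp_pos (-3)) hs1).trans ?_)
  · rintro σ ⟨h1, h2, h3⟩
    refine ⟨h1, ?_⟩
    rw [hD, Finset.filter_union]
    have h4 := Finset.card_union_le
      ((X.image (fun x => s(u, x))).filter (· ∈ (revealedGraph σ m₁).edgeSet))
      ((X.image (fun x => s(w, x))).filter (· ∈ (revealedGraph σ m₁).edgeSet))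
    have h5 := card_filter_star_le (revealedGraph σ m₁) X u
    have h6 := card_filter_star_le (revealedGraph σ m₁) X w
    have h7 := h4.trans (add_le_add h5 h6)
    have h8 : ((((X.image (fun x => s(u, x))).filter (· ∈ (revealedGraph σ m₁).edgeSet)) ∪
      ((X.image (fun x => s(w, x))).filter (· ∈ (revealedGraph σ m₁).edgeSet))).card : ℝ)
      ≤ ((revealedGraph σ m₁).neighborSet u).ncard + ((revealedGraph σ m₁).neighborSet w).ncard := by
      exact_mod_cast h7
    linarith
  · refine mul_le_mul_of_nonneg_left (Real.exp_le_exp.2 ?_) (by positivity)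
    rw [Real.log_exp, hDc]
    push_cast
    have hN : (0 : ℝ) < V.card.choose 2 := by exact_mod_cast (by omega : 0 < V.card.choose 2)
    have hm2 : (2 : ℝ) ≤ m₁ := by exact_mod_cast h2m
    have hFr : (F.card : ℝ) ≤ 2 := by exact_mod_cast hF2
    have h1 : ((m₁ : ℝ) - 2) / V.card.choose 2 ≤ ((m₁ : ℝ) - F.card) / V.card.choose 2 := by
      gcongr
    have h2 : 0 ≤ ((m₁ : ℝ) - 2) / V.card.choose 2 := div_nonneg (by linarith) hN.le
    have h3 : ((m₁ : ℝ) - 2) / V.card.choose 2 * (2 * (V.card - 3))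
        ≤ ((m₁ : ℝ) - F.card) / V.card.choose 2 * (X.card + X.card) := by
      have h4 : ((m₁ : ℝ) - 2) / V.card.choose 2 * (2 * (V.card - 3))
        ≤ ((m₁ : ℝ) - 2) / V.card.choose 2 * (X.card + X.card) :=
        mul_le_mul_of_nonneg_left (by linarith) h2
      exact h4.trans (mul_le_mul_of_nonneg_right h1 (by positivity))
    have h5 := mul_le_mul_of_nonneg_left h3 (by linarith : (0 : ℝ) ≤ 1 - Real.exp (-3))
    linarith

/-- A union bound over the points, with the lower tail at threshold one for each star. Once all
degrees are at least two, the condition on points of degree one is vacuous. -/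
lemma pr_degree_le_one_le {m : ℕ} (hm : m ≤ V.card.choose 2) (hN : 0 < V.card.choose 2) :
    pr {σ : RevealOrder V | ∃ u, ((revealedGraph σ m).neighborSet u).ncard ≤ 1}
      ≤ V.card * Real.exp (3 - (1 - Real.exp (-3)) * ((m : ℝ) / V.card.choose 2) *
          (V.card - 1)) := by
  classical
  refine (pr_iUnion_le Finset.univ
    (fun u => {σ | ((revealedGraph σ m).neighborSet u).ncard ≤ 1}) ?_).trans ?_
  · rintro σ ⟨u, hu⟩
    exact ⟨u, Finset.mem_univ _, hu⟩
  refine (Finset.sum_le_card_nsmul _ _ _ fun u _ => ?_).trans_eq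
    (by rw [nsmul_eq_mul, Finset.card_univ, Fintype.card_coe])
  have hs1 : Real.exp (-3) ≤ 1 := Real.exp_le_one_iff.2 (by norm_num)
  set D := ((Finset.univ : Finset V).erase u).image (fun x => s(u, x)) with hD
  have hDd : ∀ e ∈ D, ¬ e.IsDiag := by
    intro e he
    obtain ⟨x, hx, rfl⟩ := Finset.mem_image.1 he
    rw [Sym2.mk_isDiag_iff]
    exact (Finset.ne_of_mem_erase hx).symm
  refine (pr_mono ?_).trans ((pr_lower_tail_le ∅ D (by simp) hDd (Finset.disjoint_empty_left _)
    hm hm (by simp) (by simpa using hN) 1 (Real.exp_pos (-3)) hs1).trans (le_of_eq ?_))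
  · intro σ hσ
    refine ⟨by simp, ?_⟩
    exact_mod_cast (card_filter_star_le _ _ u).trans hσ
  · rw [Real.log_exp, hD, card_star, Finset.card_erase_of_mem (Finset.mem_univ u),
      Finset.card_univ, Fintype.card_coe]
    have : 1 ≤ V.card := Finset.card_pos.2 ⟨u, u.2⟩
    push_cast [this]
    simp

end Degrees

/-! ### Second moment method: an isolated point at the earlier time. -/

section SecondMoment

/-- Chebyshev: if `X` counts the events that occur, the indicator of `X = 0` is at most `(X / μ - 1)
^ 2`, whose average is the right-hand side. -/
lemma pr_forall_notMem_le {Ω ι : Type*} [Fintype Ω] [Nonempty Ω] (s : Finset ι) (A : ι → Set Ω)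
    {μ : ℝ} (hμ : ∑ i ∈ s, pr (A i) = μ) (hμ0 : 0 < μ) :
    pr {σ | ∀ i ∈ s, σ ∉ A i} ≤ (∑ i ∈ s, ∑ j ∈ s, pr (A i ∩ A j)) / μ ^ 2 - 1 := by
  classical
  set X : Ω → ℝ := fun σ => ∑ i ∈ s, (A i).indicator (fun _ => (1 : ℝ)) σ with hX
  have h1 : avg X = μ := by rw [hX, avg_sum]; exact hμ
  have h2 : avg (fun σ => X σ ^ 2) = ∑ i ∈ s, ∑ j ∈ s, pr (A i ∩ A j) := by
    have : ∀ σ, X σ ^ 2 = ∑ i ∈ s, ∑ j ∈ s, (A i ∩ A j).indicator (fun _ => (1 : ℝ)) σ := by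
      intro σ
      rw [pow_two, hX, Finset.sum_mul_sum]
      refine Finset.sum_congr rfl fun i _ => Finset.sum_congr rfl fun j _ => ?_
      by_cases hi : σ ∈ A i <;> by_cases hj : σ ∈ A j <;> simp [hi, hj]
    simp only [this]
    rw [avg_sum]
    refine Finset.sum_congr rfl fun i _ => ?_
    rw [avg_sum]; rfl
  refine (pr_le_avg (g := fun σ => (μ ^ 2)⁻¹ * X σ ^ 2 + ((-2 * μ⁻¹) * X σ + 1)) ?_ ?_).trans ?_
  · intro σ
    have : (μ ^ 2)⁻¹ * X σ ^ 2 + ((-2 * μ⁻¹) * X σ + 1) = (μ⁻¹ * X σ - 1) ^ 2 := by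
      rw [← inv_pow]; ring
    rw [this]; positivity
  · intro σ hσ
    have : X σ = 0 := Finset.sum_eq_zero fun i hi => by simp [hσ i hi]
    simp [this]
  · rw [avg_add, avg_add, avg_mul_left, avg_mul_left, avg_const, h1, h2]
    have : μ⁻¹ * μ = 1 := inv_mul_cancel₀ hμ0.ne'
    have h3 : -2 * μ⁻¹ * μ = -2 := by rw [mul_assoc, this]; ring
    rw [h3, div_eq_inv_mul]; linarith

/-- Factor by factor, adding `c` to both terms of a ratio at most one increases it. This compares
the chance that a second star is unrevealed, given that the first one is, with the unconditional
chance. -/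
lemma descFactorial_mul_add_le {a b : ℕ} (hab : a ≤ b) (c j : ℕ) :
    a.descFactorial j * (b + c).descFactorial j ≤ (a + c).descFactorial j * b.descFactorial j := by
  induction j with
  | zero => simp
  | succ i ih =>
    have h : (a - i) * (b + c - i) ≤ (a + c - i) * (b - i) := by
      rcases le_or_gt a i with h | h
      · simp [Nat.sub_eq_zero_of_le h]
      · obtain ⟨a', rfl⟩ := Nat.exists_eq_add_of_le h.le
        obtain ⟨b', rfl⟩ := Nat.exists_eq_add_of_le (h.le.trans hab)
        have e1 : i + a' - i = a' := by omega
        have e2 : i + b' + c - i = b' + c := by omega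
        have e3 : i + a' + c - i = a' + c := by omega
        have e4 : i + b' - i = b' := by omega
        rw [e1, e2, e3, e4]
        have : a' ≤ b' := by omega
        nlinarith [Nat.mul_le_mul_left c this]
    calc a.descFactorial (i + 1) * (b + c).descFactorial (i + 1)
        = ((a - i) * (b + c - i)) * (a.descFactorial i * (b + c).descFactorial i) := by
          rw [Nat.descFactorial_succ, Nat.descFactorial_succ]; ring
      _ ≤ ((a + c - i) * (b - i)) * ((a + c).descFactorial i * b.descFactorial i) :=
          Nat.mul_le_mul h ih
      _ = _ := by rw [Nat.descFactorial_succ, Nat.descFactorial_succ]; ring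

/-- At time `m` there is an isolated point, with high probability, if `m` is not too large. -/
lemma pr_no_isolated_le {V : Finset ℝ} {m : ℕ} (hn : 2 ≤ V.card)
    (hm : m + V.card ≤ V.card.choose 2) :
    pr {σ : RevealOrder V | ∀ u, ((revealedGraph σ m).neighborSet u).Nonempty}
      ≤ 1 / (V.card * (((V.card.choose 2 : ℝ) - m - V.card + 2) / V.card.choose 2) ^ (V.card - 1))
        + m / ((V.card.choose 2 : ℝ) - m - V.card + 2) := by
  classical
  set n := V.card with hnV
  set N := n.choose 2 with hN
  set star : V → Finset (Sym2 V) := fun u =>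
    ((Finset.univ : Finset V).erase u).image (fun x => s(u, x)) with hstar
  have hstard : ∀ u, ∀ e ∈ star u, ¬ e.IsDiag := by
    intro u e he
    obtain ⟨x, hx, rfl⟩ := Finset.mem_image.1 he
    rw [Sym2.mk_isDiag_iff]
    exact (Finset.ne_of_mem_erase hx).symm
  have hstarc : ∀ u, (star u).card = n - 1 := by
    intro u
    rw [hstar]
    simp only
    rw [card_star, Finset.card_erase_of_mem (Finset.mem_univ u), Finset.card_univ,
      Fintype.card_coe]
  set A : V → Set (RevealOrder V) := fun u =>
    {σ | ∀ e ∈ star u, e ∉ (revealedGraph σ m).edgeSet} with hA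
  have hmN : m ≤ N := by omega
  -- `q₁` and `q₂` are the probabilities that one, respectively two, given points are isolated. Two
  -- stars share one pair, hence `2 * n - 3`.
  set q₁ : ℝ := (N - m).descFactorial (n - 1) / N.descFactorial (n - 1) with hq₁
  set q₂ : ℝ := (N - m).descFactorial (2 * n - 3) / N.descFactorial (2 * n - 3) with hq₂
  have hpr1 : ∀ u, pr (A u) = q₁ := by
    intro u
    rw [hA]
    simp only
    rw [pr_unrevealed (star u) (hstard u) hmN, hstarc]
  have hpr2 : ∀ u w, u ≠ w → pr (A u ∩ A w) = q₂ := by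
    intro u w huw
    have h1 : A u ∩ A w = {σ | ∀ e ∈ star u ∪ star w, e ∉ (revealedGraph σ m).edgeSet} := by
      ext σ
      simp only [hA, Set.mem_inter_iff, Set.mem_ofPred_eq, Finset.mem_union]
      exact ⟨fun h e he => he.elim (h.1 e) (h.2 e),
        fun h => ⟨fun e he => h e (Or.inl he), fun e he => h e (Or.inr he)⟩⟩
    have h2 : (star u ∪ star w).card = 2 * n - 3 := by
      have h3 : star u ∩ star w = {s(u, w)} := by
        ext e
        simp only [hstar, Finset.mem_inter, Finset.mem_image, Finset.mem_erase, Finset.mem_univ,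
          and_true, Finset.mem_singleton]
        constructor
        · rintro ⟨⟨x, hx, rfl⟩, ⟨y, hy, h⟩⟩
          rw [Sym2.eq_iff] at h
          rcases h with ⟨h, -⟩ | ⟨h, -⟩
          · exact absurd h.symm huw
          · rw [h]
        · rintro rfl
          exact ⟨⟨w, huw.symm, rfl⟩, ⟨u, huw, Sym2.eq_swap⟩⟩
      have h4 := Finset.card_union_add_card_inter (star u) (star w)
      rw [h3, Finset.card_singleton, hstarc, hstarc] at h4
      omega
    rw [h1, pr_unrevealed _ _ hmN, h2]
    intro e he
    exact (Finset.mem_union.1 he).elim (hstard u e) (hstard w e)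
  have hnr : (2 : ℝ) ≤ n := by exact_mod_cast hn
  have hmr : (m : ℝ) + n ≤ N := by exact_mod_cast hm
  -- `B` is the last and smallest factor of the falling factorial `(N - m).descFactorial (n - 1)`.
  set B : ℝ := (N : ℝ) - m - n + 2 with hB
  have hBpos : 0 < B := by rw [hB]; linarith
  have hBN : B = ((N - m + 1 - (n - 1) : ℕ) : ℝ) := by
    have : N - m + 1 - (n - 1) + m + n = N + 2 := by omega
    have : ((N - m + 1 - (n - 1) : ℕ) : ℝ) + m + n = N + 2 := by exact_mod_cast this
    rw [hB]; linarith
  have hNpos : 0 < N := by omega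
  have hq₁low : (B / N) ^ (n - 1) ≤ q₁ := by
    rw [div_pow, hq₁, hBN]
    have h1 := Nat.pow_sub_le_descFactorial (N - m) (n - 1)
    have h2 := Nat.descFactorial_le_pow N (n - 1)
    have h3 : 0 < N.descFactorial (n - 1) := Nat.descFactorial_pos.2 (by omega)
    exact div_le_div₀ (by positivity) (by exact_mod_cast h1) (by exact_mod_cast h3)
      (by exact_mod_cast h2)
  have hBNpos : 0 < (B / N) ^ (n - 1) := by positivity
  have hq₁pos : 0 < q₁ := hBNpos.trans_le hq₁low
  -- Given one isolated point, a second needs only `n - 2` further unrevealed pairs, of probability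
  -- at most `p`. Since `q₁` is `p` times the last factor `B / (B + m)`, the two events are nearly
  -- uncorrelated.
  have hq₂le : q₂ ≤ q₁ ^ 2 * (1 + m / B) := by
    have e1 : 2 * n - 3 = (n - 1) + (n - 2) := by omega
    have e2 : n - 1 = (n - 2) + 1 := by omega
    set p : ℝ := (N - m).descFactorial (n - 2) / N.descFactorial (n - 2) with hp
    have hd1 : (0 : ℝ) < N.descFactorial (n - 2) := by
      exact_mod_cast Nat.descFactorial_pos.2 (by omega)
    have hd2 : (0 : ℝ) < (N - (n - 1)).descFactorial (n - 2) := by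
      have h2n : 2 * n - 3 ≤ N := by
        rcases Nat.lt_or_ge n 4 with h | h
        · interval_cases n <;> omega
        · have : n.choose 2 = n * (n - 1) / 2 := Nat.choose_two_right n
          have h4 : 4 * (n - 1) ≤ n * (n - 1) := Nat.mul_le_mul_right _ h
          omega
      exact_mod_cast Nat.descFactorial_pos.2 (by omega)
    have h1 : q₁ = p * (B / (B + m)) := by
      rw [hq₁, e2, Nat.descFactorial_succ, Nat.descFactorial_succ]
      push_cast
      rw [mul_div_mul_comm, mul_comm, hp, hBN]
      congr 2
      · norm_cast; omega
      · norm_cast; omega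
    have h2 : q₂ ≤ q₁ * p := by
      rw [hq₂, e1, descFactorial_add, descFactorial_add]
      push_cast
      rw [mul_div_mul_comm]
      refine mul_le_mul_of_nonneg_left ?_ hq₁pos.le
      rw [hp, div_le_div_iff₀ hd2 hd1]
      have := descFactorial_mul_add_le (a := N - m - (n - 1)) (b := N - (n - 1)) (by omega)
        (n - 1) (n - 2)
      rw [show N - (n - 1) + (n - 1) = N by omega,
        show N - m - (n - 1) + (n - 1) = N - m by omega] at this
      exact_mod_cast this
    have h3 : p = q₁ * (1 + m / B) := by
      rw [h1]
      have : B + m ≠ 0 := by positivity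
      field_simp
    rw [h3] at h2
    calc q₂ ≤ _ := h2
      _ = _ := by ring
  have hμ : ∑ u ∈ (Finset.univ : Finset V), pr (A u) = n * q₁ := by
    simp only [hpr1, Finset.sum_const, Finset.card_univ, Fintype.card_coe, nsmul_eq_mul, ← hnV]
  have hμ0 : 0 < n * q₁ := by positivity
  have hq₂0 : 0 ≤ q₂ := by rw [hq₂]; positivity
  have hsum : ∑ u ∈ (Finset.univ : Finset V), ∑ w ∈ (Finset.univ : Finset V), pr (A u ∩ A w)
      ≤ n * (q₁ + n * q₂) := by
    have h1 : ∀ u ∈ (Finset.univ : Finset V), ∑ w ∈ (Finset.univ : Finset V), pr (A u ∩ A w)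
        ≤ q₁ + n * q₂ := by
      intro u _
      have h2 : ∀ w ∈ (Finset.univ : Finset V), pr (A u ∩ A w) ≤ (if u = w then q₁ else 0) + q₂ := by
        intro w _
        by_cases h : u = w
        · subst h; rw [Set.inter_self, hpr1, if_pos rfl]; linarith
        · rw [hpr2 u w h, if_neg h]; linarith
      refine (Finset.sum_le_sum h2).trans (le_of_eq ?_)
      rw [Finset.sum_add_distrib, Finset.sum_ite_eq, if_pos (Finset.mem_univ _), Finset.sum_const,
        Finset.card_univ, Fintype.card_coe, nsmul_eq_mul, ← hnV]
    refine (Finset.sum_le_card_nsmul _ _ _ h1).trans (le_of_eq ?_)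
    rw [Finset.card_univ, Fintype.card_coe, nsmul_eq_mul, ← hnV]
  refine (pr_mono ?_).trans ((pr_forall_notMem_le Finset.univ A hμ hμ0).trans ?_)
  · intro σ hσ u _ hu
    obtain ⟨w, hw⟩ := hσ u
    have hw' : (revealedGraph σ m).Adj u w := hw
    exact hu s(u, w) (Finset.mem_image_of_mem _ (Finset.mem_erase.2
      ⟨hw'.ne', Finset.mem_univ _⟩)) hw'
  · have h1 : (∑ u ∈ (Finset.univ : Finset V), ∑ w ∈ (Finset.univ : Finset V), pr (A u ∩ A w))
        / (n * q₁) ^ 2 ≤ (n * (q₁ + n * (q₁ ^ 2 * (1 + m / B)))) / (n * q₁) ^ 2 := by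
      gcongr
      refine hsum.trans ?_
      gcongr
    have h2 : (n * (q₁ + n * (q₁ ^ 2 * (1 + m / B)))) / (n * q₁) ^ 2
        = 1 / (n * q₁) + (1 + m / B) := by
      field_simp
    have h3 : 1 / (n * q₁) ≤ 1 / (n * (B / N) ^ (n - 1)) := by
      gcongr
    linarith

end SecondMoment
-- Separation of the low-degree points, and coincidence of the hitting times.
section Combine
variable {V : Finset ℝ}

lemma pr_iUnion_le_mul {Ω ι : Type*} [Fintype Ω] [Fintype ι] (Q : Finset ι) (A : ι → Set Ω)
    {B : Set Ω} {M c : ℝ} (h : ∀ σ ∈ B, ∃ i ∈ Q, σ ∈ A i) (hM : (Fintype.card ι : ℝ) = M)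
    (hc0 : 0 ≤ c) (hc : ∀ i ∈ Q, pr (A i) ≤ c) : pr B ≤ M * c := by
  refine (pr_iUnion_le Q A h).trans ((Finset.sum_le_card_nsmul Q _ c hc).trans ?_)
  rw [nsmul_eq_mul, ← hM]
  exact mul_le_mul_of_nonneg_right (by exact_mod_cast Finset.card_le_univ Q) hc0

/-- The points which have low degree at time `m`. -/
def lowDegree (σ : RevealOrder V) (m : ℕ) (k : ℝ) : Set V :=
  {u | (((revealedGraph σ m).neighborSet u).ncard : ℝ) ≤ k}

lemma pr_low_adj_le {m₁ m₂ : ℕ} (hm₁ : m₁ ≤ V.card.choose 2) (hm₂ : m₂ ≤ V.card.choose 2)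
    (h2m : 2 ≤ m₁) (h2N : 2 < V.card.choose 2) (k : ℝ) :
    pr {σ : RevealOrder V | ∃ u ∈ lowDegree σ m₁ k, ∃ w ∈ lowDegree σ m₁ k,
        (revealedGraph σ m₂).Adj u w}
      ≤ (V.card : ℝ) ^ 2 * (((m₂ : ℝ) / V.card.choose 2) *
        Real.exp (6 * k - (1 - Real.exp (-3)) * (((m₁ : ℝ) - 2) / V.card.choose 2) *
          (2 * (V.card - 3)))) := by
  classical
  set Q : Finset (V × V) := Finset.univ.filter (fun p => p.1 ≠ p.2) with hQ
  refine pr_iUnion_le_mul Q (fun p => {σ | (∀ e ∈ ({s(p.1, p.2)} : Finset (Sym2 V)),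
    e ∈ (revealedGraph σ m₂).edgeSet) ∧ p.1 ∈ lowDegree σ m₁ k ∧ p.2 ∈ lowDegree σ m₁ k})
    ?_ ?_ (by positivity) fun p hp => ?_
  · rintro σ ⟨u, hu, w, hw, huw⟩
    exact ⟨(u, w), by simp [hQ, huw.ne], by simpa using huw, hu, hw⟩
  · rw [Fintype.card_prod, Fintype.card_coe]
    push_cast; ring
  · simp only [hQ, Finset.mem_filter, Finset.mem_univ, true_and] at hp
    -- There is no middle point here, so `p.1` fills the place of `v`.
    have := pr_low_pair_le hm₁ hm₂ h2m h2N (v := p.1) hp {s(p.1, p.2)}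
      (by simpa using hp) (by simp) (by simp) k
    rw [Finset.card_singleton, pow_one] at this
    exact this

/-- The extra factor `V.card` for the choice of the middle point is paid for by the second revealed
pair. -/
lemma pr_low_common_le {m₁ m₂ : ℕ} (hm₁ : m₁ ≤ V.card.choose 2) (hm₂ : m₂ ≤ V.card.choose 2)
    (h2m : 2 ≤ m₁) (h2N : 2 < V.card.choose 2) (k : ℝ) :
    pr {σ : RevealOrder V | ∃ u ∈ lowDegree σ m₁ k, ∃ w ∈ lowDegree σ m₁ k, u ≠ w ∧
        ∃ v, (revealedGraph σ m₂).Adj u v ∧ (revealedGraph σ m₂).Adj v w}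
      ≤ (V.card : ℝ) ^ 3 * (((m₂ : ℝ) / V.card.choose 2) ^ 2 *
        Real.exp (6 * k - (1 - Real.exp (-3)) * (((m₁ : ℝ) - 2) / V.card.choose 2) *
          (2 * (V.card - 3)))) := by
  classical
  set Q : Finset (V × V × V) := Finset.univ.filter
    (fun p => p.1 ≠ p.2.1 ∧ p.2.1 ≠ p.2.2 ∧ p.1 ≠ p.2.2) with hQ
  refine pr_iUnion_le_mul Q (fun p => {σ | (∀ e ∈ ({s(p.1, p.2.1), s(p.2.1, p.2.2)} : Finset (Sym2 V)),
    e ∈ (revealedGraph σ m₂).edgeSet) ∧ p.1 ∈ lowDegree σ m₁ k ∧ p.2.2 ∈ lowDegree σ m₁ k})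
    ?_ ?_ (by positivity) fun p hp => ?_
  · rintro σ ⟨u, hu, w, hw, huw, v, huv, hvw⟩
    exact ⟨(u, v, w), by simp [hQ, huv.ne, hvw.ne, huw], by simpa using ⟨huv, hvw⟩, hu, hw⟩
  · rw [Fintype.card_prod, Fintype.card_prod, Fintype.card_coe]
    push_cast; ring
  · simp only [hQ, Finset.mem_filter, Finset.mem_univ, true_and] at hp
    obtain ⟨h1, h2, h3⟩ := hp
    have hne : s(p.1, p.2.1) ≠ s(p.2.1, p.2.2) := by
      rw [Ne, Sym2.eq_iff]
      rintro (⟨h, -⟩ | ⟨h, -⟩)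
      · exact h1 h
      · exact h3 h
    have hc : ({s(p.1, p.2.1), s(p.2.1, p.2.2)} : Finset (Sym2 V)).card = 2 :=
      Finset.card_pair hne
    have := pr_low_pair_le hm₁ hm₂ h2m h2N (v := p.2.1) h3 {s(p.1, p.2.1), s(p.2.1, p.2.2)}
      (by simpa using ⟨h1, h2⟩) hc.le (by
        intro e he
        simp only [Finset.mem_insert, Finset.mem_singleton] at he ⊢
        tauto) k
    rw [hc] at this
    exact this

/-- The point `w` is determined by `u` and `v`, so there are only quadratically many choices, and
one revealed pair is enough to compensate. -/
lemma pr_low_reflection_le {m₁ m₂ : ℕ} (hm₁ : m₁ ≤ V.card.choose 2) (hm₂ : m₂ ≤ V.card.choose 2)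
    (h2m : 2 ≤ m₁) (h2N : 2 < V.card.choose 2) (k : ℝ) :
    pr {σ : RevealOrder V | ∃ u ∈ lowDegree σ m₁ k, ∃ w ∈ lowDegree σ m₁ k,
        ∃ v, (revealedGraph σ m₂).Adj u v ∧ (w : ℝ) = 2 * v - u}
      ≤ (V.card : ℝ) ^ 2 * (((m₂ : ℝ) / V.card.choose 2) *
        Real.exp (6 * k - (1 - Real.exp (-3)) * (((m₁ : ℝ) - 2) / V.card.choose 2) *
          (2 * (V.card - 3)))) := by
  classical
  set Q : Finset (V × V) := Finset.univ.filter
    (fun p => p.1 ≠ p.2 ∧ 2 * (p.2 : ℝ) - p.1 ∈ V) with hQ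
  refine pr_iUnion_le_mul Q (fun p => {σ | (∀ e ∈ ({s(p.1, p.2)} : Finset (Sym2 V)),
    e ∈ (revealedGraph σ m₂).edgeSet) ∧ p.1 ∈ lowDegree σ m₁ k ∧
      ∃ w ∈ lowDegree σ m₁ k, (w : ℝ) = 2 * p.2 - p.1})
    ?_ ?_ (by positivity) fun p hp => ?_
  · rintro σ ⟨u, hu, w, hw, v, huv, hwv⟩
    refine ⟨(u, v), ?_, by simpa using huv, hu, w, hw, hwv⟩
    simp only [hQ, Finset.mem_filter, Finset.mem_univ, true_and]
    exact ⟨huv.ne, hwv ▸ w.2⟩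
  · rw [Fintype.card_prod, Fintype.card_coe]
    push_cast; ring
  · simp only [hQ, Finset.mem_filter, Finset.mem_univ, true_and] at hp
    obtain ⟨h1, h2⟩ := hp
    have h3 : p.1 ≠ ⟨2 * (p.2 : ℝ) - p.1, h2⟩ := by
      intro h
      have h' : (p.1 : ℝ) = 2 * (p.2 : ℝ) - p.1 := congrArg Subtype.val h
      exact h1 (Subtype.ext (by linarith))
    have := pr_low_pair_le hm₁ hm₂ h2m h2N (v := p.2) h3 {s(p.1, p.2)}
      (by simpa using h1) (by simp) (by simp) k
    rw [Finset.card_singleton, pow_one] at this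
    refine (pr_mono ?_).trans this
    rintro σ ⟨h4, h5, w, hw, hw'⟩
    refine ⟨h4, h5, ?_⟩
    have : w = ⟨2 * (p.2 : ℝ) - p.1, h2⟩ := Subtype.ext hw'
    rw [← this]; exact hw

/-- The event that the two hitting times exist and coincide. -/
def hittingTimesAgree (V : Finset ℝ) : Set (RevealOrder V) :=
  {σ | ∃ t : ℕ, IsLeast {s : ℕ | NoIsolatedNoUndecidable V (revealedGraph σ s)} t ∧
    IsLeast {s : ℕ | Reconstructible V (revealedGraph σ s)} t}

/-- A reveal order lies in one of seven exceptional events unless the hitting times agree. -/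
lemma compl_hittingTimesAgree_subset {m₁ m₂ : ℕ} {x d : ℝ} (hV : 3 ≤ V.card) (hx0 : 0 < x)
    (hx : 6 * x ≤ V.card) :
    (hittingTimesAgree V)ᶜ ⊆
      {σ : RevealOrder V | ∀ u, ((revealedGraph σ m₁).neighborSet u).Nonempty} ∪
      ({σ | ∃ A B : Finset V, Disjoint A B ∧ x ≤ A.card ∧ x ≤ B.card ∧
        ∀ u ∈ A, ∀ v ∈ B, ¬ (revealedGraph σ m₁).Adj u v} ∪
      ({σ | ∃ L : Finset V, L.Nonempty ∧ (L.card : ℝ) ≤ 2 * x ∧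
        ∀ u ∈ L, d < (((revealedGraph σ m₂).neighborSet u ∩ L).ncard : ℝ)} ∪
      ({σ | ∃ u ∈ lowDegree σ m₁ (d + 2), ∃ w ∈ lowDegree σ m₁ (d + 2),
        (revealedGraph σ m₂).Adj u w} ∪
      ({σ | ∃ u ∈ lowDegree σ m₁ (d + 2), ∃ w ∈ lowDegree σ m₁ (d + 2), u ≠ w ∧
        ∃ v, (revealedGraph σ m₂).Adj u v ∧ (revealedGraph σ m₂).Adj v w} ∪
      ({σ | ∃ u ∈ lowDegree σ m₁ (d + 2), ∃ w ∈ lowDegree σ m₁ (d + 2),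
        ∃ v, (revealedGraph σ m₂).Adj u v ∧ (w : ℝ) = 2 * v - u} ∪
      {σ | ∃ u, ((revealedGraph σ m₂).neighborSet u).ncard ≤ 1}))))) := by
  classical
  intro σ hσ
  by_contra hcon
  simp only [Set.mem_union, Set.mem_ofPred_eq, not_or] at hcon
  obtain ⟨e1, e2, e3, e4, e5, e6, e7⟩ := hcon
  push Not at e1 e2 e3 e4 e5 e6 e7
  apply hσ
  have hex : ∃ t, NoIsolatedNoUndecidable V (revealedGraph σ t) := by
    refine ⟨m₂, fun u => ?_, fun u v huv => ?_⟩
    · rw [← Set.ncard_pos (Set.toFinite _)]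
      exact (Nat.zero_lt_one).trans (e7 u)
    · have := e7 u
      rw [huv, Set.ncard_singleton] at this
      omega
  set τ := Nat.find hex with hτ
  have hτN : NoIsolatedNoUndecidable V (revealedGraph σ τ) := Nat.find_spec hex
  have h1 : m₁ ≤ τ := by
    by_contra h
    obtain ⟨u, hu⟩ := e1
    obtain ⟨w, hw⟩ := hτN.1 u
    have : w ∈ (revealedGraph σ m₁).neighborSet u :=
      revealedGraph_mono σ (not_le.1 h).le hw
    rw [hu] at this
    exact this
  have h2 : τ ≤ m₂ := by
    refine Nat.find_min' hex ⟨fun u => ?_, fun u v huv => ?_⟩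
    · rw [← Set.ncard_pos (Set.toFinite _)]
      exact (Nat.zero_lt_one).trans (e7 u)
    · have := e7 u
      rw [huv, Set.ncard_singleton] at this
      omega
  have g1 := revealedGraph_mono σ h1
  have g2 := revealedGraph_mono σ h2
  -- Joinedness and large degrees pass upward from `m₁`; sparsity and separation pass downward from
  -- `m₂`. The set of low-degree points is frozen at time `m₁`.
  have hps : Pseudorandom V (revealedGraph σ τ) (lowDegree σ m₁ (d + 2)) x d :=
    { joined := fun A B hAB hA hB => by
        obtain ⟨u, hu, v, hv, huv⟩ := e2 A B hAB hA hB
        exact ⟨u, hu, v, hv, g1 huv⟩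
      sparse := fun L hL hL' => by
        obtain ⟨u, hu, h⟩ := e3 L hL hL'
        refine ⟨u, hu, le_trans ?_ h⟩
        have : ((revealedGraph σ τ).neighborSet u ∩ L).ncard
            ≤ ((revealedGraph σ m₂).neighborSet u ∩ L).ncard :=
          Set.ncard_le_ncard (fun v hv => ⟨g2 hv.1, hv.2⟩) (Set.toFinite _)
        exact_mod_cast this
      degree := fun u hu => by
        have h3 : d + 2 < (((revealedGraph σ m₁).neighborSet u).ncard : ℝ) := not_le.1 hu
        refine h3.trans_le ?_
        have : ((revealedGraph σ m₁).neighborSet u).ncard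
            ≤ ((revealedGraph σ τ).neighborSet u).ncard :=
          Set.ncard_le_ncard (fun v hv => g1 hv) (Set.toFinite _)
        exact_mod_cast this
      not_adj := fun u hu w hw h => e4 u hu w hw (g2 h)
      no_common := fun u hu w hw huw v h => e5 u hu w hw huw v (g2 h.1) (g2 h.2)
      no_reflection := fun u hu w hw v h => e6 u hu w hw v (g2 h) }
  refine ⟨τ, ⟨hτN, fun s hs => Nat.find_min' hex hs⟩, ?_, fun s hs => ?_⟩
  · exact reconstructible_of_pseudorandom hx0 (by rwa [Fintype.card_coe]) hps hτN
  -- Reconstructibility implies the two conditions at every time, so it cannot hold before `τ`.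
  · exact Nat.find_min' hex (noIsolatedNoUndecidable_of_reconstructible hV hs)

end Combine

/-! ### Numerical estimates in terms of `l = log n`. -/

section Asymptotics
open Real

/-- The ranges of the two times between which the hitting time lies, in terms of `l = log n`. -/
structure TimeBounds (n N m₁ m₂ l : ℝ) : Prop where
  n_eq : n = exp l
  l_large : 10000 ≤ l
  N_eq : N = n * (n - 1) / 2
  m₁_le : m₁ ≤ 2 / 5 * (n * l)
  le_m₁ : 2 / 5 * (n * l) - 1 ≤ m₁
  m₂_le : m₂ ≤ n * l + 1
  le_m₂ : n * l ≤ m₂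

namespace TimeBounds
variable {n N m₁ m₂ l : ℝ}

lemma mul_l_le (h : TimeBounds n N m₁ m₂ l) : 1000 * l ≤ n := by
  have h1 := quadratic_le_exp_of_nonneg (by linarith [h.l_large] : 0 ≤ l)
  rw [h.n_eq]
  nlinarith [h.l_large]

lemma n_large (h : TimeBounds n N m₁ m₂ l) : 10000000 ≤ n := by
  linarith [h.mul_l_le, h.l_large]

lemma N_le (h : TimeBounds n N m₁ m₂ l) : N ≤ n ^ 2 / 2 := by
  rw [h.N_eq]; nlinarith [h.n_large]

lemma le_N (h : TimeBounds n N m₁ m₂ l) : 99 / 200 * n ^ 2 ≤ N := by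
  rw [h.N_eq]; nlinarith [h.n_large]

lemma N_pos (h : TimeBounds n N m₁ m₂ l) : 0 < N := by
  have := h.le_N
  have := h.n_large
  nlinarith

lemma n_mul_l_le (h : TimeBounds n N m₁ m₂ l) : n * l ≤ n ^ 2 / 1000 := by
  nlinarith [h.mul_l_le, h.n_large]

lemma le_n_mul_l (h : TimeBounds n N m₁ m₂ l) : 10000 * n ≤ n * l := by
  nlinarith [h.l_large, h.n_large]

lemma m₂_le_N (h : TimeBounds n N m₁ m₂ l) : m₂ ≤ N := by
  nlinarith [h.m₂_le, h.n_mul_l_le, h.le_N, h.n_large]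

lemma m₁_add_le_N (h : TimeBounds n N m₁ m₂ l) : m₁ + n ≤ N := by
  nlinarith [h.m₁_le, h.n_mul_l_le, h.le_N, h.n_large]

lemma two_lt_m₁ (h : TimeBounds n N m₁ m₂ l) : 2 < m₁ := by
  linarith [h.le_m₁, h.le_n_mul_l, h.n_large]

lemma le_density_early (h : TimeBounds n N m₁ m₂ l) : 79 / 100 * (l / n) ≤ (m₁ - 2) / N := by
  have hn : 0 < n := by linarith [h.n_large]
  rw [← mul_div_assoc, div_le_div_iff₀ hn h.N_pos]
  have h1 : 79 / 200 * (n * l) ≤ m₁ - 2 := by linarith [h.le_m₁, h.le_n_mul_l, h.n_large]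
  have hl : 0 ≤ l := by linarith [h.l_large]
  have h2 := mul_le_mul_of_nonneg_left h.N_le (by positivity : 0 ≤ 79 / 100 * l)
  have h3 := mul_le_mul_of_nonneg_right h1 hn.le
  nlinarith

lemma density_late_le (h : TimeBounds n N m₁ m₂ l) : m₂ / N ≤ 3 * (l / n) := by
  have hn : 0 < n := by linarith [h.n_large]
  rw [← mul_div_assoc, div_le_div_iff₀ h.N_pos hn]
  have hl : 0 ≤ l := by linarith [h.l_large]
  have h2 := mul_le_mul_of_nonneg_left h.le_N (by positivity : 0 ≤ 3 * l)
  have h3 := mul_le_mul_of_nonneg_right h.m₂_le hn.le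
  have h4 : 1000 * n ≤ n * (n * l) := by nlinarith [h.le_n_mul_l, h.n_large]
  nlinarith

lemma le_density_late (h : TimeBounds n N m₁ m₂ l) : 2 * (l / n) ≤ m₂ / N := by
  have hn : 0 < n := by linarith [h.n_large]
  rw [← mul_div_assoc, div_le_div_iff₀ hn h.N_pos]
  have hl : 0 ≤ l := by linarith [h.l_large]
  have h2 := mul_le_mul_of_nonneg_left h.N_le (by positivity : 0 ≤ 2 * l)
  have h3 := mul_le_mul_of_nonneg_right h.le_m₂ hn.le
  nlinarith

lemma l_div_n (h : TimeBounds n N m₁ m₂ l) : l / n = l * exp (-l) := by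
  rw [h.n_eq, exp_neg]; rfl

/-- The density at `m₁` is about `0.8 * l / n`, so the mean number of isolated points is at least `n
* exp (-(9 / 10 * l)) = exp (l / 10)`; the second summand is the correlation error. -/
lemma isolated_bound (h : TimeBounds n N m₁ m₂ l) {k : ℕ} (hk : (k : ℝ) ≤ n) :
    1 / (n * ((N - m₁ - n + 2) / N) ^ k) + m₁ / (N - m₁ - n + 2)
      ≤ exp (-(l / 10)) + 4 * (l * exp (-l)) := by
  have hn : 0 < n := by linarith [h.n_large]
  have hN := h.N_pos
  have hl : 0 < l := by linarith [h.l_large]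
  have hB : n ^ 2 / 4 ≤ N - m₁ - n + 2 := by
    nlinarith [h.m₁_le, h.n_mul_l_le, h.le_N, h.n_large]
  have hBpos : 0 < N - m₁ - n + 2 := lt_of_lt_of_le (by positivity) hB
  refine add_le_add ?_ ?_
  · set y := (m₁ + n - 2) / N with hy
    have hBy : (N - m₁ - n + 2) / N = 1 - y := by
      rw [hy]; field_simp; ring
    have hy0 : 0 ≤ y := div_nonneg (by linarith [h.two_lt_m₁]) hN.le
    have hy1 : y ≤ 17 / 20 * (l / n) := by
      rw [hy, ← mul_div_assoc, div_le_div_iff₀ hN hn]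
      have h1 : m₁ + n - 2 ≤ 41 / 100 * (n * l) := by linarith [h.m₁_le, h.le_n_mul_l]
      have h2 := mul_le_mul_of_nonneg_right h1 hn.le
      have h3 := mul_le_mul_of_nonneg_left h.le_N (by positivity : 0 ≤ 17 / 20 * l)
      have : 0 < n ^ 2 * l := by positivity
      nlinarith
    have hln : l / n ≤ 1 / 1000 := by
      rw [div_le_div_iff₀ hn (by norm_num)]; linarith [h.mul_l_le]
    have hy2 : y ≤ 1 / 100 := by linarith
    have h1y : 0 < 1 - y := by linarith
    have hlow : exp (-(9 / 10 * (l / n))) ≤ 1 - y := by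
      have h1 : y / (1 - y) ≤ 9 / 10 * (l / n) := by
        rw [div_le_iff₀ h1y]
        have : 0 ≤ l / n := by positivity
        nlinarith
      have h2 := add_one_le_exp (y / (1 - y))
      have h3 : y / (1 - y) + 1 = (1 - y)⁻¹ := by field_simp; ring
      rw [h3] at h2
      have h4 : (1 - y)⁻¹ ≤ exp (9 / 10 * (l / n)) := h2.trans (exp_le_exp.2 h1)
      rw [exp_neg]
      exact inv_le_of_inv_le₀ h1y h4
    have hpow : exp (-(9 / 10 * l)) ≤ (1 - y) ^ k := by
      refine le_trans ?_ (pow_le_pow_left₀ (exp_nonneg _) hlow k)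
      rw [← exp_nat_mul]
      refine exp_le_exp.2 ?_
      have h1 : (k : ℝ) * (9 / 10 * (l / n)) ≤ n * (9 / 10 * (l / n)) :=
        mul_le_mul_of_nonneg_right hk (by positivity)
      have h2 : n * (9 / 10 * (l / n)) = 9 / 10 * l := by field_simp
      linarith
    rw [hBy]
    have h1 : exp (l / 10) ≤ n * (1 - y) ^ k := by
      have h2 : exp (l / 10) = n * exp (-(9 / 10 * l)) := by
        rw [h.n_eq, ← exp_add]; congr 1; ring
      rw [h2]
      exact mul_le_mul_of_nonneg_left hpow hn.le
    rw [exp_neg, one_div]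
    exact inv_anti₀ (exp_pos _) h1
  · rw [← h.l_div_n, ← mul_div_assoc, div_le_div_iff₀ hBpos hn]
    have h1 := mul_le_mul_of_nonneg_left hB (by positivity : 0 ≤ 4 * l)
    have h2 := mul_le_mul_of_nonneg_right h.m₁_le hn.le
    have : 0 < n ^ 2 * l := by positivity
    nlinarith

/-- The number of pairs of sets is at most `exp (2 * n)`, while the exponent is at least `79 / 100 *
(c ^ 2 * l) * n`, hence over `3 * n` once `c ^ 2 * l ≥ 4`. -/
lemma joined_bound (h : TimeBounds n N m₁ m₂ l) {k : ℕ} (hk : (k : ℝ) = n) {c : ℝ} (hc : 0 < c)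
    (hcl : 4 / c ^ 2 ≤ l) :
    4 ^ k * exp (-(m₁ / N * (c * n) ^ 2)) ≤ exp (-l) := by
  have hn : 0 < n := by linarith [h.n_large]
  have h4 : (4 : ℝ) ^ k ≤ exp (2 * n) := by
    have : (4 : ℝ) ≤ exp 2 := by
      have := quadratic_le_exp_of_nonneg (by norm_num : (0 : ℝ) ≤ 2)
      linarith
    refine (pow_le_pow_left₀ (by norm_num) this k).trans (le_of_eq ?_)
    rw [← exp_nat_mul, hk, mul_comm]
  refine (mul_le_mul_of_nonneg_right h4 (exp_nonneg _)).trans ?_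
  rw [← exp_add]
  refine exp_le_exp.2 ?_
  have h1 : 79 / 100 * (l / n) ≤ m₁ / N :=
    h.le_density_early.trans (div_le_div_of_nonneg_right (by linarith) h.N_pos.le)
  have h2 := mul_le_mul_of_nonneg_right h1 (by positivity : 0 ≤ (c * n) ^ 2)
  have h3 : 79 / 100 * (l / n) * (c * n) ^ 2 = 79 / 100 * (c ^ 2 * l) * n := by field_simp
  have h5 : 4 ≤ c ^ 2 * l := by
    rw [div_le_iff₀ (by positivity)] at hcl; linarith
  have h6 := mul_le_mul_of_nonneg_right h5 hn.le
  linarith [h.mul_l_le, h.l_large]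

/-- With `θ = 120` the factor `exp (-120) / 6` in the size of the sets cancels `exp θ`, so the
positive term is at most `l`. The degree `l / 20 - 2` gives `-3 * l + 120`, and the net `120 - 2 *
l` absorbs the factor `n`. -/
lemma sparse_bound (h : TimeBounds n N m₁ m₂ l) :
    exp (n * exp (exp 120 * (m₂ / N) * (2 * (exp (-120) / 6 * n)) - 120 * ((l / 20 - 2) / 2))) - 1
      ≤ exp (exp (120 - l)) - 1 := by
  have hn : 0 < n := by linarith [h.n_large]
  refine sub_le_sub_right (exp_le_exp.2 ?_) 1
  have h1 : exp 120 * (m₂ / N) * (2 * (exp (-120) / 6 * n)) = (m₂ / N) * n / 3 := by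
    have : exp (120 : ℝ) * exp (-120) = 1 := by rw [← exp_add]; simp
    linear_combination (m₂ / N * n / 3) * this
  have h2 : m₂ / N * n ≤ 3 * l := by
    have := mul_le_mul_of_nonneg_right h.density_late_le hn.le
    have h3 : 3 * (l / n) * n = 3 * l := by field_simp
    linarith
  rw [h1]
  calc n * exp (m₂ / N * n / 3 - 120 * ((l / 20 - 2) / 2))
      ≤ n * exp (120 - 2 * l) := by
        refine mul_le_mul_of_nonneg_left (exp_le_exp.2 ?_) hn.le
        linarith
    _ = exp (120 - l) := by rw [h.n_eq, ← exp_add]; congr 1; ring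

lemma exp_neg_three_le : exp (-3) ≤ 1 / 16 := by
  have h1 : (16 : ℝ) ≤ exp 3 := by
    have h2 : exp 3 = exp 1 ^ 3 := by rw [← exp_nat_mul]; norm_num
    rw [h2]
    have := exp_one_gt_d9
    calc (16 : ℝ) ≤ 2.7 ^ 3 := by norm_num
      _ ≤ exp 1 ^ 3 := pow_le_pow_left₀ (by norm_num) (by linarith) 3
  rw [exp_neg, one_div]
  exact inv_anti₀ (by norm_num) h1

/-- Low degree means at most `l / 20`, which costs `0.3 * l`, against a gain of over `1.46 * l` from
two stars. A net rate above `l` is essential: the union bounds over pairs and triples leave a factor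
`n` up to powers of `l`. -/
lemma low_bound (h : TimeBounds n N m₁ m₂ l) :
    exp (6 * (l / 20 - 2 + 2) - (1 - exp (-3)) * ((m₁ - 2) / N) * (2 * (n - 3)))
      ≤ exp (-(11 / 10 * l)) := by
  have hn : 0 < n := by linarith [h.n_large]
  have hl : 0 < l := by linarith [h.l_large]
  refine exp_le_exp.2 ?_
  have h1 : 15 / 16 * (79 / 100 * (l / n)) ≤ (1 - exp (-3)) * ((m₁ - 2) / N) :=
    mul_le_mul (by linarith [exp_neg_three_le]) h.le_density_early (by positivity)
      (by linarith [exp_neg_three_le])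
  have h2 : 99 / 50 * n ≤ 2 * (n - 3) := by linarith [h.n_large]
  have h3 := mul_le_mul h1 h2 (by positivity) (le_trans (by positivity) h1)
  have h4 : 15 / 16 * (79 / 100 * (l / n)) * (99 / 50 * n) = 15 / 16 * (79 / 100) * (99 / 50) * l := by
    field_simp
  rw [h4] at h3
  linarith

lemma low_pair_bound (h : TimeBounds n N m₁ m₂ l) :
    n ^ 2 * (m₂ / N *
      exp (6 * (l / 20 - 2 + 2) - (1 - exp (-3)) * ((m₁ - 2) / N) * (2 * (n - 3))))
      ≤ 3 * (l * exp (-(1 / 10 * l))) := by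
  have hn : 0 < n := by linarith [h.n_large]
  have hl : 0 < l := by linarith [h.l_large]
  calc _ ≤ n ^ 2 * (3 * (l / n) * exp (-(11 / 10 * l))) := by
        refine mul_le_mul_of_nonneg_left ?_ (by positivity)
        exact mul_le_mul h.density_late_le h.low_bound (exp_nonneg _) (by positivity)
    _ = 3 * (l * (n * exp (-(11 / 10 * l)))) := by field_simp
    _ = _ := by rw [h.n_eq, ← exp_add]; congr 3; ring

lemma low_triple_bound (h : TimeBounds n N m₁ m₂ l) :
    n ^ 3 * ((m₂ / N) ^ 2 *
      exp (6 * (l / 20 - 2 + 2) - (1 - exp (-3)) * ((m₁ - 2) / N) * (2 * (n - 3))))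
      ≤ 9 * (l ^ 2 * exp (-(1 / 10 * l))) := by
  have hn : 0 < n := by linarith [h.n_large]
  have hl : 0 < l := by linarith [h.l_large]
  have h0 : 0 ≤ m₂ / N := le_trans (by positivity) h.le_density_late
  calc _ ≤ n ^ 3 * ((3 * (l / n)) ^ 2 * exp (-(11 / 10 * l))) := by
        refine mul_le_mul_of_nonneg_left ?_ (by positivity)
        exact mul_le_mul (pow_le_pow_left₀ h0 h.density_late_le 2) h.low_bound (exp_nonneg _)
          (by positivity)
    _ = 9 * (l ^ 2 * (n * exp (-(11 / 10 * l)))) := by field_simp; ring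
    _ = _ := by rw [h.n_eq, ← exp_add]; congr 3; ring

lemma degree_bound (h : TimeBounds n N m₁ m₂ l) :
    n * exp (3 - (1 - exp (-3)) * (m₂ / N) * (n - 1)) ≤ exp (3 - 1 / 2 * l) := by
  have hn : 0 < n := by linarith [h.n_large]
  have hl : 0 < l := by linarith [h.l_large]
  have h1 : 15 / 16 * (2 * (l / n)) ≤ (1 - exp (-3)) * (m₂ / N) :=
    mul_le_mul (by linarith [exp_neg_three_le]) h.le_density_late (by positivity)
      (by linarith [exp_neg_three_le])
  have h2 : 9 / 10 * n ≤ n - 1 := by linarith [h.n_large]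
  have h3 := mul_le_mul h1 h2 (by positivity) (le_trans (by positivity) h1)
  have h4 : 15 / 16 * (2 * (l / n)) * (9 / 10 * n) = 27 / 16 * l := by field_simp; norm_num
  rw [h4] at h3
  calc _ ≤ n * exp (3 - 27 / 16 * l) :=
        mul_le_mul_of_nonneg_left (exp_le_exp.2 (by linarith)) hn.le
    _ = exp (l + (3 - 27 / 16 * l)) := by rw [exp_add, ← h.n_eq]
    _ ≤ _ := exp_le_exp.2 (by linarith)

end TimeBounds

/-- An upper bound for the probability of failure in terms of the logarithm of the number of
points. -/
noncomputable def failureBound (l : ℝ) : ℝ :=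
  (exp (-(l / 10)) + 4 * (l * exp (-l))) + (exp (-l) + ((exp (exp (120 - l)) - 1) +
    (3 * (l * exp (-(1 / 10 * l))) + (9 * (l ^ 2 * exp (-(1 / 10 * l))) +
      (3 * (l * exp (-(1 / 10 * l))) + exp (3 - 1 / 2 * l))))))

open Filter Topology in
lemma tendsto_failureBound : Tendsto failureBound atTop (𝓝 0) := by
  have h1 : ∀ (k : ℕ) (b : ℝ), 0 < b → Tendsto (fun l => l ^ k * exp (-(b * l))) atTop (𝓝 0) := by
    intro k b hb
    have := tendsto_pow_mul_exp_neg_atTop_nhds_zero k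
    have h2 := (this.comp (tendsto_id.const_mul_atTop hb)).const_mul ((b ^ k)⁻¹)
    rw [mul_zero] at h2
    refine h2.congr fun l => ?_
    simp only [Function.comp, id, mul_pow]
    have : b ^ k ≠ 0 := by positivity
    field_simp
  have e0 : Tendsto (fun l : ℝ => exp (-(l / 10))) atTop (𝓝 0) :=
    (h1 0 (1 / 10) (by norm_num)).congr fun l => by
      rw [pow_zero, one_mul]; congr 2; ring
  have e1 : Tendsto (fun l : ℝ => 4 * (l * exp (-l))) atTop (𝓝 0) := by
    have := (h1 1 1 (by norm_num)).const_mul 4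
    simpa using this
  have e2 : Tendsto (fun l : ℝ => exp (-l)) atTop (𝓝 0) := by
    simpa using h1 0 1 (by norm_num)
  have e3 : Tendsto (fun l : ℝ => exp (exp (120 - l)) - 1) atTop (𝓝 0) := by
    have h2 : Tendsto (fun l : ℝ => exp (120 - l)) atTop (𝓝 0) := by
      have := e2.const_mul (exp 120)
      rw [mul_zero] at this
      refine this.congr fun l => ?_
      rw [← exp_add]; rfl
    have h3 := (continuous_exp.tendsto 0).comp h2
    rw [exp_zero] at h3
    simpa using h3.sub_const 1
  have e4 : Tendsto (fun l : ℝ => 3 * (l * exp (-(1 / 10 * l)))) atTop (𝓝 0) := by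
    have := (h1 1 (1 / 10) (by norm_num)).const_mul 3
    simpa using this
  have e5 : Tendsto (fun l : ℝ => 9 * (l ^ 2 * exp (-(1 / 10 * l)))) atTop (𝓝 0) := by
    have := (h1 2 (1 / 10) (by norm_num)).const_mul 9
    rwa [mul_zero] at this
  have e6 : Tendsto (fun l : ℝ => exp (3 - 1 / 2 * l)) atTop (𝓝 0) := by
    have := (h1 0 (1 / 2) (by norm_num)).const_mul (exp 3)
    rw [mul_zero] at this
    refine this.congr fun l => ?_
    rw [pow_zero, one_mul, ← exp_add]; rfl
  have := (e0.add e1).add (e2.add (e3.add (e4.add (e5.add (e4.add e6)))))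
  simp only [add_zero] at this
  exact this

end Asymptotics

/-! ### Choice of parameters and conclusion. -/

section Main

lemma pr_compl_hittingTimesAgree_le {V : Finset ℝ} {l : ℝ} (hl : l = Real.log V.card)
    (hl1 : 10000 ≤ l) (hl2 : 4 / (Real.exp (-120) / 6) ^ 2 ≤ l) :
    pr (hittingTimesAgree V)ᶜ ≤ failureBound l := by
  set n := V.card with hn
  -- The threshold for isolated points is `1 / 2 * (n * l)`. The coefficient `2 / 5` is below it,
  -- yet large enough for two low-degree points to be rarer than `1 / n`.
  set m₁ := ⌊2 / 5 * ((n : ℝ) * l)⌋₊ with hm₁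
  set m₂ := ⌈(n : ℝ) * l⌉₊ with hm₂
  have hn0 : 0 < n := by
    -- For empty `V` the convention `Real.log 0 = 0` contradicts `10000 ≤ l`.
    rcases Nat.eq_zero_or_pos n with h | h
    · rw [h] at hl; simp at hl; linarith
    · exact h
  have hn0' : (0 : ℝ) < n := by exact_mod_cast hn0
  have hb : TimeBounds n (n.choose 2 : ℕ) m₁ m₂ l :=
    { n_eq := by rw [hl, Real.exp_log hn0']
      l_large := hl1
      N_eq := Nat.cast_choose_two ℝ n
      m₁_le := Nat.floor_le (by positivity)
      le_m₁ := (Nat.sub_one_lt_floor _).le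
      m₂_le := (Nat.ceil_lt_add_one (by positivity)).le
      le_m₂ := Nat.le_ceil _ }
  have hmN₁ : m₁ + n ≤ n.choose 2 := by exact_mod_cast hb.m₁_add_le_N
  have hmN₂ : m₂ ≤ n.choose 2 := by exact_mod_cast hb.m₂_le_N
  have h2m : 2 < m₁ := by exact_mod_cast hb.two_lt_m₁
  have hn3 : 3 ≤ n := by
    have : (3 : ℝ) ≤ n := by linarith [hb.n_large]
    exact_mod_cast this
  have hmN₁' : m₁ ≤ n.choose 2 := by omega
  have h2N : 2 < n.choose 2 := by omega
  set x : ℝ := Real.exp (-120) / 6 * n with hx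
  have hx0 : 0 < x := by positivity
  have hx6 : 6 * x ≤ n := by
    have : Real.exp (-120) ≤ 1 := Real.exp_le_one_iff.2 (by norm_num)
    rw [hx]
    nlinarith
  refine (pr_mono (compl_hittingTimesAgree_subset (m₁ := m₁) (m₂ := m₂) (x := x)
    (d := l / 20 - 2) hn3 hx0 hx6)).trans ?_
  unfold failureBound
  refine (pr_union_le _ _).trans (add_le_add ?_ ?_)
  · exact (pr_no_isolated_le (by omega) hmN₁).trans (hb.isolated_bound (by
      exact_mod_cast Nat.sub_le _ _))
  refine (pr_union_le _ _).trans (add_le_add ?_ ?_)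
  · exact (pr_not_joined_le hmN₁' hx0.le).trans (hb.joined_bound rfl (by positivity) hl2)
  refine (pr_union_le _ _).trans (add_le_add ?_ ?_)
  · exact (pr_not_sparse_le hmN₂ (by norm_num : (0 : ℝ) ≤ 120)).trans hb.sparse_bound
  refine (pr_union_le _ _).trans (add_le_add ?_ ?_)
  · exact (pr_low_adj_le hmN₁' hmN₂ h2m.le h2N _).trans hb.low_pair_bound
  refine (pr_union_le _ _).trans (add_le_add ?_ ?_)
  · exact (pr_low_common_le hmN₁' hmN₂ h2m.le h2N _).trans hb.low_triple_bound
  refine (pr_union_le _ _).trans (add_le_add ?_ ?_)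
  · exact (pr_low_reflection_le hmN₁' hmN₂ h2m.le h2N _).trans hb.low_pair_bound
  · exact (pr_degree_le_one_le hmN₂ (Nat.zero_lt_two.trans h2N)).trans hb.degree_bound

end Main
end LineReconstruction

open LineReconstruction in
theorem theorem1p3 :
    ∀ ε : ℝ, 0 < ε → ∃ N : ℕ, ∀ V : Finset ℝ, N ≤ V.card →
      1 - ε ≤ (ProbabilityTheory.uniformOn (Set.univ : Set (RevealOrder V))).real
        {σ : RevealOrder V | ∃ t : ℕ,
          IsLeast {s : ℕ | NoIsolatedNoUndecidable V (revealedGraph σ s)} t ∧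
          IsLeast {s : ℕ | Reconstructible V (revealedGraph σ s)} t} := by
  intro ε hε
  have hlog : Filter.Tendsto (fun n : ℕ => Real.log n) Filter.atTop Filter.atTop :=
    Real.tendsto_log_atTop.comp tendsto_natCast_atTop_atTop
  -- The bound involves only the number of points, so one threshold works for all sets `V`.
  have h1 := (tendsto_failureBound.comp hlog).eventually_le_const hε
  have h2 := hlog.eventually_ge_atTop 10000
  have h3 := hlog.eventually_ge_atTop (4 / (Real.exp (-120) / 6) ^ 2)
  obtain ⟨N, hN⟩ := Filter.eventually_atTop.1 (h1.and (h2.and h3))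
  refine ⟨N, fun V hV => ?_⟩
  obtain ⟨h1, h2, h3⟩ := hN V.card hV
  have h4 := (pr_compl_hittingTimesAgree_le rfl h2 h3).trans h1
  have : MeasurableSingletonClass (RevealOrder V) := ⟨fun _ => trivial⟩
  rw [uniformOn_univ_real]
  change 1 - ε ≤ pr (hittingTimesAgree V)
  rw [pr_compl] at h4
  linarith
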